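/- All vector spaces are over $\mathbb{C}$. Let $V$ be a vertex operator algebra with Virasoro element $\omega$ and write $Y(a,z)=\sum_{n\in\mathbb{Z}}a(n)z^{-n-1}$, $L(n)=\omega(n+1)$. Let $M^1,M^2,M^3$ be ordinary $V$-modules, $M^i=\bigoplus_{n\ge 0}M^i(n)$ with $\dim M^i(n)<\infty$ and $L(0)=h_i+n$ on $M^i(n)$; for $v\in M^i(n)$ write $\deg v=n$. Put $h=h_1+h_2-h_3$. Let $(M^3)'=\bigoplus_{n\ge0}M^3(n)^*$ be the contragredient module of $M^3$ (with $\deg=n$ on $M^3(n)^*$), and on it let $a'(n)=\sum_{j\ge 0}\frac{(-1)^{\mathrm{wt}\,a}}{j!}(L(1)^ja)(2\,\mathrm{wt}\,a-n-j-2)$ for homogeneous $a\in V$. **Restricted conformal blocks.** Let $w\in\mathbb{C}\setminus\{0\}$. The $w$-restricted chiral Lie algebra $\mathcal{L}_{\mathbb{P}^1\setminus\{0,\infty\}}(V)_{\le 0}$ is the span of the classes $a\otimes z^n(z-w)^p$ with $a\in V$ homogeneous, $n,p\in\mathbb{Z}$, $p\ge \mathrm{wt}\,a-1$, in $\big(V\otimes\mathbb{C}[z^{\pm1},(z-w)^{\pm1}]\big)/\mathrm{Im}\big(L(-1)\otimes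 1+1\otimes \tfrac{d}{dz}\big)$. It acts on $W:=(M^3)'\otimes M^1(0)\otimes M^2$ by $$\begin{aligned}(a\otimes z^n(z-w)^p).(v_3'\otimes v_1\otimes v_2)=&-\sum_{j\ge0}\binom{p}{j}(-w)^j\,a'(n+p-j)v_3'\otimes v_1\otimes v_2+\sum_{j\ge0}\binom{n}{j}w^{n-j}\,v_3'\otimes a(p+j)v_1\otimes v_2\\&+\sum_{j\ge0}\binom{p}{j}(-w)^{p-j}\,v_3'\otimes v_1\otimes a(n+j)v_2 .\end{aligned}$$ The space $\mathscr{C}\big(\Sigma_w((M^3)',M^1(0),M^2)\big)$ of $w$-restricted conformal blocks is the dual space of $W/\mathcal{L}_{\mathbb{P}^1\setminus\{0,\infty\}}(V)_{\le0}.W$. **Generalized intertwining operators.** $I\binom{M^3}{M^1(0)\;M^2}$ is the space of linear maps $v_1\mapsto\Phi(v_1,w)=\sum_{n\in\mathbb{Z}}v_1(n)w^{-n-1-h}$ on $M^1(0)$ ($w$ a formal variable, $v_1(n)\in\mathrm{Hom}_{\mathbb{C}}(M^2,M^3)$) such that 1. for all $v_1\in M^1(0)$, $v_2\in M^2$: $v_1(n)v_2=0$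 for $n\gg0$; 2. $[L(-1),\Phi(v_1,w)]=\frac{d}{dw}\Phi(v_1,w)$; 3. for all homogeneous $a\in V$ and $v_1\in M^1(0)$, $$(z-w)^{\mathrm{wt}\,a-1}Y_{M^3}(a,z)\Phi(v_1,w)-(-w+z)^{\mathrm{wt}\,a-1}\Phi(v_1,w)Y_{M^2}(a,z)=z^{-1}\delta\!\left(\frac{w}{z}\right)\Phi(a(\mathrm{wt}\,a-1)v_1,w),$$ where $(z-w)^m$ is expanded in nonnegative powers of $w$ and $(-w+z)^m$ in nonnegative powers of $z$. **Proposition.** For every $w\in\mathbb{C}\setminus\{0\}$ there are linear isomorphisms $$\mathscr{C}\big(\Sigma_1((M^3)',M^1(0),M^2)\big)\to\mathscr{C}\big(\Sigma_w((M^3)',M^1(0),M^2)\big),\ \varphi_1\mapsto\varphi_w,\qquad \mathscr{C}\big(\Sigma_w((M^3)',M^1(0),M^2)\big)\to I\binom{M^3}{M^1(0)\;M^2},\ \varphi_w\mapsto\Phi,$$ such that for all $v_1\in M^1(0)$ and all homogeneous $v_3'\in(M^3)'$, $v_2\in M^2$, $$\langle\varphi_w|v_3'\otimes v_1\otimes v_2\rangle=\langle\varphi_1|v_3'\otimes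 v_1\otimes v_2\rangle\,w^{\deg v_3'-\deg v_2},$$ $$\langle v_3'|v_1(n)v_2\rangle=\begin{cases}\langle\varphi_1|v_3'\otimes v_1\otimes v_2\rangle&\text{if }\deg v_3'=\deg v_2-n-1,\\0&\text{otherwise}\end{cases}\qquad(n\in\mathbb{Z}).$$ Moreover, for all $v_3'\in(M^3)'$, $v_1\in M^1(0)$, $v_2\in M^2$, only finitely many $\langle v_3'|v_1(n)v_2\rangle$ are nonzero, and with the principal branch of the powers of the number $w$, $$\sum_{n\in\mathbb{Z}}\langle v_3'|v_1(n)v_2\rangle\,w^{-n-1-h}=\langle\varphi_w|v_3'\otimes v_1\otimes v_2\rangle\,w^{-h}.$$ -/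

import Mathlib

open scoped TensorProduct

noncomputable section

/-- A vertex operator algebra structure on a complex vector space `V`. The `n`-th mode `a(n)` of
`Y(a,z) = ∑ a(n) z^{-n-1}` is `Y a n`. The Jacobi identity is written in components
(Borcherds' identity). -/
structure VertexOperatorAlgebra (V : Type*) [AddCommGroup V] [Module ℂ V] where
  /-- The weight spaces `V_n`. -/
  gr : ℤ → Submodule ℂ V
  isInternal : DirectSum.IsInternal gr
  finiteDimensional : ∀ n, FiniteDimensional ℂ (gr n)
  boundedBelow : ∃ N : ℤ, ∀ n < N, gr n = ⊥
  /-- The vacuum element. -/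
  one : V
  one_mem : one ∈ gr 0
  /-- The Virasoro element. -/
  omega : V
  omega_mem : omega ∈ gr 2
  /-- The state-field correspondence, `Y a n = a(n)`. -/
  Y : V →ₗ[ℂ] (ℤ → Module.End ℂ V)
  truncation : ∀ a b, ∃ N : ℤ, ∀ n ≥ N, Y a n b = 0
  vacuum : ∀ n, Y one n = if n = -1 then 1 else 0
  creation : ∀ a, Y a (-1) one = a ∧ ∀ n ≥ 0, Y a n one = 0
  jacobi : ∀ (a b u : V) (l m n : ℤ),
    ∑ᶠ i : ℕ, ((-1 : ℂ) ^ i * (Ring.choose l i : ℤ)) • Y a (m + l - i) (Y b (n + i) u)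
      - ∑ᶠ i : ℕ, ((-1 : ℂ) ^ (l + i) * (Ring.choose l i : ℤ)) • Y b (n + l - i) (Y a (m + i) u)
      = ∑ᶠ i : ℕ, ((Ring.choose m i : ℤ) : ℂ) • Y (Y a (l + i) b) (m + n - i) u
  /-- The central charge. -/
  charge : ℂ
  /-- The Virasoro relation for `L(n) = ω(n+1)`. -/
  virasoro : ∀ m n : ℤ,
    Y omega (m + 1) * Y omega (n + 1) - Y omega (n + 1) * Y omega (m + 1)
      = ((m : ℂ) - n) • Y omega (m + n + 1)
        + (if m + n = 0 then ((m : ℂ) ^ 3 - m) / 12 * charge else 0) • (1 : Module.End ℂ V)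
  /-- `Y(L(-1)a,z) = d/dz Y(a,z)`. -/
  derivative : ∀ (a : V) (n : ℤ), Y (Y omega 0 a) n = (-(n : ℂ)) • Y a (n - 1)
  /-- `L(0)a = n a` for `a ∈ V_n`. -/
  L0_eigen : ∀ (n : ℤ), ∀ a ∈ gr n, Y omega 1 a = (n : ℂ) • a

/-- An ordinary module `M = ⨁_{n ≥ 0} M(n)` over a vertex operator algebra. The grading is indexed
by `ℤ` and vanishes in negative degrees. -/
structure OrdinaryModule {V : Type*} [AddCommGroup V] [Module ℂ V] (A : VertexOperatorAlgebra V)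
    (M : Type*) [AddCommGroup M] [Module ℂ M] where
  /-- The degree-`n` subspaces `M(n)`. -/
  gr : ℤ → Submodule ℂ M
  gr_neg : ∀ n < 0, gr n = ⊥
  isInternal : DirectSum.IsInternal gr
  finiteDimensional : ∀ n, FiniteDimensional ℂ (gr n)
  /-- The module vertex operator, `Y a n = a(n)`. -/
  Y : V →ₗ[ℂ] (ℤ → Module.End ℂ M)
  truncation : ∀ a u, ∃ N : ℤ, ∀ n ≥ N, Y a n u = 0
  vacuum : ∀ n, Y A.one n = if n = -1 then 1 else 0
  jacobi : ∀ (a b : V) (u : M) (l m n : ℤ),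
    ∑ᶠ i : ℕ, ((-1 : ℂ) ^ i * (Ring.choose l i : ℤ)) • Y a (m + l - i) (Y b (n + i) u)
      - ∑ᶠ i : ℕ, ((-1 : ℂ) ^ (l + i) * (Ring.choose l i : ℤ)) • Y b (n + l - i) (Y a (m + i) u)
      = ∑ᶠ i : ℕ, ((Ring.choose m i : ℤ) : ℂ) • Y (A.Y a (l + i) b) (m + n - i) u
  derivative : ∀ (a : V) (n : ℤ), Y (A.Y A.omega 0 a) n = (-(n : ℂ)) • Y a (n - 1)
  grading : ∀ (k m n : ℤ), ∀ a ∈ A.gr k, ∀ u ∈ gr n, Y a m u ∈ gr (n + k - m - 1)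
  /-- The conformal weight `h` of the module. -/
  h : ℂ
  /-- `L(0)v = (h + n) v` for `v ∈ M(n)`. -/
  L0_eigen : ∀ (n : ℤ), ∀ u ∈ gr n, Y A.omega 1 u = (h + n) • u

/-- The pointwise sum of a locally finite family of linear maps. -/
def locallyFiniteSum {E F : Type*} [AddCommGroup E] [Module ℂ E] [AddCommGroup F] [Module ℂ F]
    (f : ℕ → E →ₗ[ℂ] F) (hf : ∀ x, (Function.support fun j => f j x).Finite) : E →ₗ[ℂ] F where
  toFun x := ∑ᶠ j, f j x
  map_add' x y := by
    simp only [map_add]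
    exact finsum_add_distrib (hf x) (hf y)
  map_smul' c x := by
    simp only [map_smul, RingHom.id_apply]
    exact (smul_finsum c _).symm

lemma finite_support_of_eventually_zero {F : Type*} [Zero F] (f : ℕ → F) (N : ℕ)
    (h : ∀ j ≥ N, f j = 0) : (Function.support f).Finite :=
  (Set.finite_lt_nat N).subset fun j hj => by
    by_contra hc
    exact hj (h j (not_lt.mp hc))

namespace VertexOperatorAlgebra

variable {V : Type*} [AddCommGroup V] [Module ℂ V] (A : VertexOperatorAlgebra V)

/-- `L(1) = ω(2)` on `V`. -/
def L1 : Module.End ℂ V := A.Y A.omega 2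

lemma L1_mem {k : ℤ} {a : V} (ha : a ∈ A.gr k) : A.L1 a ∈ A.gr (k - 1) := by
  classical
  let _ := A.isInternal.chooseDecomposition
  have key : ∀ (b : V) (i : ℤ),
      (DirectSum.decompose A.gr (A.Y A.omega 1 b) i : V)
        = (i : ℂ) • (DirectSum.decompose A.gr b i : V) := by
    intro b i
    induction b using DirectSum.Decomposition.inductionOn A.gr with
    | zero => simp
    | @homogeneous j m =>
      rw [A.L0_eigen j m m.2, DirectSum.decompose_smul, DirectSum.smul_apply, Submodule.coe_smul]
      by_cases hij : j = i
      · subst hij; rfl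
      · rw [DirectSum.decompose_of_mem_ne A.gr m.2 hij]; simp
    | add m m' hm hm' => simp [DirectSum.decompose_add, hm, hm', smul_add]
  have hv := A.virasoro 0 1
  have hv2 := congrArg (fun T => T a) hv
  simp only [LinearMap.sub_apply, Module.End.mul_apply, LinearMap.add_apply,
    LinearMap.smul_apply] at hv2
  norm_num at hv2
  rw [A.L0_eigen k a ha, map_smul] at hv2
  have hL : A.Y A.omega 1 (A.L1 a) = ((k : ℂ) - 1) • A.L1 a := by
    unfold L1
    rw [sub_smul, one_smul]
    rw [sub_eq_iff_eq_add.mp hv2]; abel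
  have hz : ∀ i, i ≠ k - 1 → (DirectSum.decompose A.gr (A.L1 a) i : V) = 0 := by
    intro i hi
    have h1 := key (A.L1 a) i
    rw [hL, DirectSum.decompose_smul, DirectSum.smul_apply, Submodule.coe_smul] at h1
    have h2 : (((k : ℂ) - 1) - i) • (DirectSum.decompose A.gr (A.L1 a) i : V) = 0 := by
      rw [sub_smul, h1, sub_self]
    rcases smul_eq_zero.mp h2 with h3 | h3
    · exfalso
      apply hi
      have : ((k - 1 - i : ℤ) : ℂ) = 0 := by push_cast; exact h3
      have := Int.cast_eq_zero.mp this
      omega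
    · exact h3
  rw [← DirectSum.sum_support_decompose A.gr (A.L1 a)]
  refine Submodule.sum_mem _ fun i _ => ?_
  by_cases hi : i = k - 1
  · subst hi; exact SetLike.coe_mem _
  · rw [hz i hi]; exact Submodule.zero_mem _

lemma L1_pow_mem {k : ℤ} {a : V} (ha : a ∈ A.gr k) (j : ℕ) : (A.L1 ^ j) a ∈ A.gr (k - j) := by
  induction j with
  | zero => simpa using ha
  | succ j ih =>
    rw [pow_succ', Module.End.mul_apply]
    have := A.L1_mem ih
    have e : k - ((j + 1 : ℕ) : ℤ) = k - j - 1 := by push_cast; ring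
    rw [e]; exact this

end VertexOperatorAlgebra

namespace OrdinaryModule

variable {V : Type*} [AddCommGroup V] [Module ℂ V] {A : VertexOperatorAlgebra V}
variable {M : Type*} [AddCommGroup M] [Module ℂ M] (S : OrdinaryModule A M)

/-- For `a` of weight `k`, the `z^{-n-1}` coefficient
`a'(n) = ∑_j (-1)^k / j! (L(1)^j a)(2k - n - j - 2)` of
`Y'_M(a,z) = Y_M(e^{zL(1)} (-z^{-2})^{L(0)} a, z^{-1})`, as an operator on `M`. -/
def oppositeMode (k : ℤ) (a : V) (n : ℤ) : Module.End ℂ M :=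
  ∑ᶠ j : ℕ, ((-1 : ℂ) ^ k / (j.factorial : ℂ)) • S.Y ((A.L1 ^ j) a) (2 * k - n - j - 2)

lemma oppositeMode_mem {k : ℤ} {a : V} (ha : a ∈ A.gr k) (n m : ℤ) {u : M} (hu : u ∈ S.gr m) :
    S.oppositeMode k a n u ∈ S.gr (m + n + 1 - k) := by
  unfold oppositeMode
  refine finsum_induction (p := fun T : Module.End ℂ M => T u ∈ S.gr (m + n + 1 - k))
    (by simp) (fun T T' h h' => Submodule.add_mem _ h h') fun j => ?_
  refine Submodule.smul_mem _ _ ?_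
  have := S.grading _ (2 * k - n - j - 2) m _ (A.L1_pow_mem ha j) u hu
  have e : m + (k - (j : ℤ)) - (2 * k - n - j - 2) - 1 = m + n + 1 - k := by ring
  rwa [e] at this

/-- The functionals on `M` that vanish on all but finitely many `M(n)`, i.e. `⨁ M(n)^*`. -/
def gradedDual : Submodule ℂ (Module.Dual ℂ M) where
  carrier := {f | ∃ N : ℤ, ∀ m ≥ N, ∀ u ∈ S.gr m, f u = 0}
  zero_mem' := ⟨0, fun _ _ _ _ => rfl⟩
  add_mem' := by
    rintro f g ⟨N, hf⟩ ⟨N', hg⟩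
    refine ⟨max N N', fun m hm u hu => ?_⟩
    rw [LinearMap.add_apply, hf m (le_trans (le_max_left _ _) hm) u hu,
      hg m (le_trans (le_max_right _ _) hm) u hu, add_zero]
  smul_mem' := by
    rintro c f ⟨N, hf⟩
    exact ⟨N, fun m hm u hu => by rw [LinearMap.smul_apply, hf m hm u hu, smul_zero]⟩

/-- The underlying space `M' = ⨁ M(n)^*` of the contragredient module. -/
def Contragredient : Type _ := S.gradedDual

instance : AddCommGroup S.Contragredient := inferInstanceAs (AddCommGroup S.gradedDual)

instance : Module ℂ S.Contragredient := inferInstanceAs (Module ℂ S.gradedDual)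

/-- The natural pairing `⟨f, u⟩` of `M'` with `M`. -/
def pairing : S.Contragredient →ₗ[ℂ] Module.Dual ℂ M := S.gradedDual.subtype

/-- The degree-`m` subspace `M'(m) = M(m)^*` of the contragredient module. -/
def dualGr (m : ℤ) : Submodule ℂ S.Contragredient where
  carrier := {f | ∀ i ≠ m, ∀ u ∈ S.gr i, S.pairing f u = 0}
  zero_mem' := fun _ _ _ _ => rfl
  add_mem' := fun {f g} hf hg i hi u hu => by
    simp [hf i hi u hu, hg i hi u hu]
  smul_mem' := fun c f hf i hi u hu => by
    simp [hf i hi u hu]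

/-- The mode `a(n)` of the contragredient vertex operator, for `a` of weight `k`:
`⟨a(n) f, u⟩ = ⟨f, a'(n) u⟩`. -/
def dualMode {k : ℤ} {a : V} (ha : a ∈ A.gr k) (n : ℤ) : Module.End ℂ S.Contragredient :=
  (S.oppositeMode k a n).dualMap.restrict fun f hf => by
    obtain ⟨N, hN⟩ := hf
    refine ⟨N - n - 1 + k, fun m hm u hu => ?_⟩
    exact hN _ (by omega) _ (S.oppositeMode_mem ha n m hu)

/-- The operator `a'(n) = ∑_j (-1)^k / j! (L(1)^j a)(2k - n - j - 2)` on `M'`, for `a` of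
weight `k`, where the modes are those of the contragredient module. -/
def dualOppositeMode {k : ℤ} {a : V} (ha : a ∈ A.gr k) (n : ℤ) : Module.End ℂ S.Contragredient :=
  ∑ᶠ j : ℕ, ((-1 : ℂ) ^ k / (j.factorial : ℂ)) •
    S.dualMode (A.L1_pow_mem ha j) (2 * k - n - j - 2)

lemma dualOppositeMode_truncation {k : ℤ} {a : V} (ha : a ∈ A.gr k) (f : S.Contragredient) :
    ∃ N : ℤ, ∀ n ≤ N, S.dualOppositeMode ha n f = 0 := by
  obtain ⟨N, hN⟩ := f.2
  refine ⟨k - 1 - N, fun q hq => ?_⟩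
  unfold dualOppositeMode
  refine finsum_induction (p := fun T : Module.End ℂ S.Contragredient => T f = 0)
    (by simp) (fun T T' h h' => by simp [h, h']) fun j => ?_
  rw [LinearMap.smul_apply]
  refine smul_eq_zero_of_right _ (Subtype.ext ?_)
  refine LinearMap.ext fun u => ?_
  have hu : u ∈ (⨆ i, S.gr i) := by
    rw [S.isInternal.submodule_iSup_eq_top]; trivial
  induction hu using Submodule.iSup_induction' with
  | mem i x hx =>
    by_cases hi : i < 0
    · rw [S.gr_neg i hi] at hx
      rw [(Submodule.mem_bot ℂ).mp hx]; simp
    · exact hN _ (by omega) _ (S.oppositeMode_mem (A.L1_pow_mem ha j) (2 * k - q - j - 2) i hx)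
  | zero => simp
  | add x y _ _ hx hy => rw [map_add, map_add, hx, hy]

/-- The action at `∞` of `a ⊗ z^n (z-w)^p` on `M'`, for `a` of weight `k`:
`f ↦ - ∑_j binom(p,j) (-w)^j a'(n + p - j) f`. -/
def rhoInfty (w : ℂ) {k : ℤ} {a : V} (ha : a ∈ A.gr k) (n p : ℤ) : Module.End ℂ S.Contragredient :=
  -locallyFiniteSum
    (fun j : ℕ => ((Ring.choose p j : ℤ) * (-w) ^ j : ℂ) • S.dualOppositeMode ha (n + p - j))
    (fun f => by
      obtain ⟨N, hN⟩ := S.dualOppositeMode_truncation ha f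
      refine finite_support_of_eventually_zero _ (n + p - N).toNat fun j hj => ?_
      rw [LinearMap.smul_apply, hN _ (by omega), smul_zero])

/-- The action at `w` of `a ⊗ z^n (z-w)^p` on `M`:
`u ↦ ∑_j binom(n,j) w^{n-j} a(p + j) u`. -/
def rhoW (w : ℂ) (a : V) (n p : ℤ) : Module.End ℂ M :=
  locallyFiniteSum
    (fun j : ℕ => ((Ring.choose n j : ℤ) * w ^ (n - j) : ℂ) • S.Y a (p + j))
    (fun u => by
      obtain ⟨N, hN⟩ := S.truncation a u
      refine finite_support_of_eventually_zero _ (N - p).toNat fun j hj => ?_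
      rw [LinearMap.smul_apply, hN _ (by omega), smul_zero])

/-- The action at `0` of `a ⊗ z^n (z-w)^p` on `M`:
`u ↦ ∑_j binom(p,j) (-w)^{p-j} a(n + j) u`. -/
def rhoZero (w : ℂ) (a : V) (n p : ℤ) : Module.End ℂ M :=
  locallyFiniteSum
    (fun j : ℕ => ((Ring.choose p j : ℤ) * (-w) ^ (p - j) : ℂ) • S.Y a (n + j))
    (fun u => by
      obtain ⟨N, hN⟩ := S.truncation a u
      refine finite_support_of_eventually_zero _ (N - n).toNat fun j hj => ?_
      rw [LinearMap.smul_apply, hN _ (by omega), smul_zero])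

lemma Y_bottom_mem {k : ℤ} {a : V} (ha : a ∈ A.gr k) {p : ℤ} (hp : k - 1 ≤ p) {u : M}
    (hu : u ∈ S.gr 0) : S.Y a p u ∈ S.gr 0 := by
  have h := S.grading k p 0 a ha u hu
  rcases eq_or_lt_of_le hp with h1 | h1
  · rwa [show (0 : ℤ) + k - p - 1 = 0 by omega] at h
  · rw [S.gr_neg _ (by omega)] at h
    rw [(Submodule.mem_bot ℂ).mp h]; exact Submodule.zero_mem _

/-- The action of `a_{[wt a - 1]}` on the bottom degree `M(0)`. -/
def zeroMode {k : ℤ} {a : V} (ha : a ∈ A.gr k) : Module.End ℂ (S.gr 0) :=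
  (S.Y a (k - 1)).restrict fun _ hu => S.Y_bottom_mem ha le_rfl hu

/-- For `p ≥ wt a - 1`, the action at `w` of `a ⊗ z^n (z-w)^p` preserves `M(0)`. -/
def rhoWBottom (w : ℂ) {k : ℤ} {a : V} (ha : a ∈ A.gr k) (n : ℤ) {p : ℤ} (hp : k - 1 ≤ p) :
    Module.End ℂ (S.gr 0) :=
  (S.rhoW w a n p).restrict fun u hu =>
    finsum_induction (p := fun x => x ∈ S.gr 0) (Submodule.zero_mem _)
      (fun _ _ h h' => Submodule.add_mem _ h h')
      fun j => Submodule.smul_mem _ _ (S.Y_bottom_mem ha (by omega) hu)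

end OrdinaryModule

/-- The action of the class of `a ⊗ z^n (z-w)^p`, for `a` of weight `k` and `p ≥ k - 1`, on
`(M³)' ⊗ M¹(0) ⊗ M²`. These classes span the `w`-restricted chiral Lie algebra. -/
def restrictedChiralAction {V : Type*} [AddCommGroup V] [Module ℂ V] {A : VertexOperatorAlgebra V}
    {M₁ M₂ M₃ : Type*} [AddCommGroup M₁] [Module ℂ M₁] [AddCommGroup M₂] [Module ℂ M₂]
    [AddCommGroup M₃] [Module ℂ M₃] (S₁ : OrdinaryModule A M₁) (S₂ : OrdinaryModule A M₂)
    (S₃ : OrdinaryModule A M₃) (w : ℂ) {k : ℤ} {a : V} (ha : a ∈ A.gr k) (n : ℤ) {p : ℤ}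
    (hp : k - 1 ≤ p) : Module.End ℂ (S₃.Contragredient ⊗[ℂ] (S₁.gr 0 ⊗[ℂ] M₂)) :=
  (S₃.rhoInfty w ha n p).rTensor (S₁.gr 0 ⊗[ℂ] M₂)
    + ((S₁.rhoWBottom w ha n hp).rTensor M₂).lTensor S₃.Contragredient
    + ((S₂.rhoZero w a n p).lTensor (S₁.gr 0)).lTensor S₃.Contragredient

/-- The image of `(M³)' ⊗ M¹(0) ⊗ M²` under the action of the `w`-restricted chiral Lie algebra. -/
def restrictedChiralImage {V : Type*} [AddCommGroup V] [Module ℂ V] {A : VertexOperatorAlgebra V}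
    {M₁ M₂ M₃ : Type*} [AddCommGroup M₁] [Module ℂ M₁] [AddCommGroup M₂] [Module ℂ M₂]
    [AddCommGroup M₃] [Module ℂ M₃] (S₁ : OrdinaryModule A M₁) (S₂ : OrdinaryModule A M₂)
    (S₃ : OrdinaryModule A M₃) (w : ℂ) : Submodule ℂ (S₃.Contragredient ⊗[ℂ] (S₁.gr 0 ⊗[ℂ] M₂)) :=
  Submodule.span ℂ {x | ∃ (k : ℤ) (a : V) (ha : a ∈ A.gr k) (n p : ℤ) (hp : k - 1 ≤ p)
    (t : S₃.Contragredient ⊗[ℂ] (S₁.gr 0 ⊗[ℂ] M₂)), x = restrictedChiralAction S₁ S₂ S₃ w ha n hp t}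

/-- The space of `w`-restricted conformal blocks. -/
abbrev RestrictedConformalBlocks {V : Type*} [AddCommGroup V] [Module ℂ V]
    {A : VertexOperatorAlgebra V} {M₁ M₂ M₃ : Type*} [AddCommGroup M₁] [Module ℂ M₁]
    [AddCommGroup M₂] [Module ℂ M₂] [AddCommGroup M₃] [Module ℂ M₃] (S₁ : OrdinaryModule A M₁)
    (S₂ : OrdinaryModule A M₂) (S₃ : OrdinaryModule A M₃) (w : ℂ) : Type _ :=
  Module.Dual ℂ ((S₃.Contragredient ⊗[ℂ] (S₁.gr 0 ⊗[ℂ] M₂)) ⧸ restrictedChiralImage S₁ S₂ S₃ w)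

/-- The value `⟨φ | f ⊗ v₁ ⊗ v₂⟩` of a `w`-restricted conformal block. -/
def RestrictedConformalBlocks.eval {V : Type*} [AddCommGroup V] [Module ℂ V]
    {A : VertexOperatorAlgebra V} {M₁ M₂ M₃ : Type*} [AddCommGroup M₁] [Module ℂ M₁]
    [AddCommGroup M₂] [Module ℂ M₂] [AddCommGroup M₃] [Module ℂ M₃] {S₁ : OrdinaryModule A M₁}
    {S₂ : OrdinaryModule A M₂} {S₃ : OrdinaryModule A M₃} {w : ℂ}
    (φ : RestrictedConformalBlocks S₁ S₂ S₃ w) (f : S₃.Contragredient) (v₁ : S₁.gr 0) (v₂ : M₂) : ℂ :=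
  φ (Submodule.Quotient.mk (f ⊗ₜ[ℂ] (v₁ ⊗ₜ[ℂ] v₂)))

/-- The truncation property of `Φ(v₁,w) = ∑ v₁(n) w^{-n-1-h}`; the coefficient `v₁(n)` is
`Φ v₁ n`. -/
def IsTruncated {U M₂ M₃ : Type*} [AddCommGroup U] [Module ℂ U] [AddCommGroup M₂] [Module ℂ M₂]
    [AddCommGroup M₃] [Module ℂ M₃] (Φ : U →ₗ[ℂ] (ℤ → (M₂ →ₗ[ℂ] M₃))) : Prop :=
  ∀ v₁ v₂, ∃ N : ℤ, ∀ n ≥ N, Φ v₁ n v₂ = 0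

/-- The space of generalized intertwining operators from `M¹(0)`: linear maps
`v₁ ↦ Φ(v₁,w) = ∑ v₁(n) w^{-n-1-h}`, `h = h₁ + h₂ - h₃`, given by their coefficients
`Φ v₁ n = v₁(n)`, subject to
* truncation;
* `[L(-1), Φ(v₁,w)] = d/dw Φ(v₁,w)`, i.e. the coefficients of `w^{-n-1-h}` agree for all `n`;
* the restricted Jacobi identity
  `(z-w)^{wt a-1} Y(a,z) Φ(v₁,w) - (-w+z)^{wt a-1} Φ(v₁,w) Y(a,z)
    = z^{-1} δ(w/z) Φ(a_{[wt a-1]} v₁, w)`, i.e. the coefficients of `z^{-n-1} w^{-q-1-h}`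
  agree for all `n` and `q`. -/
def GeneralizedIntertwiningOperators {V : Type*} [AddCommGroup V] [Module ℂ V]
    {A : VertexOperatorAlgebra V} {M₁ M₂ M₃ : Type*} [AddCommGroup M₁] [Module ℂ M₁]
    [AddCommGroup M₂] [Module ℂ M₂] [AddCommGroup M₃] [Module ℂ M₃] (S₁ : OrdinaryModule A M₁)
    (S₂ : OrdinaryModule A M₂) (S₃ : OrdinaryModule A M₃) :
    Submodule ℂ (S₁.gr 0 →ₗ[ℂ] (ℤ → (M₂ →ₗ[ℂ] M₃))) where
  carrier := {Φ |
    IsTruncated Φ ∧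
    (∀ (v₁ : S₁.gr 0) (n : ℤ),
      S₃.Y A.omega 0 ∘ₗ Φ v₁ n - Φ v₁ n ∘ₗ S₂.Y A.omega 0
        = (-(n : ℂ) - (S₁.h + S₂.h - S₃.h)) • Φ v₁ (n - 1)) ∧
    (∀ (k : ℤ) (a : V) (ha : a ∈ A.gr k) (v₁ : S₁.gr 0) (v₂ : M₂) (n q : ℤ),
      ∑ᶠ j : ℕ, ((-1 : ℂ) ^ j * (Ring.choose (k - 1) j : ℤ)) •
          S₃.Y a (n + (k - 1) - j) (Φ v₁ (q + j) v₂)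
        - ∑ᶠ j : ℕ, ((-1 : ℂ) ^ (k - 1 - j) * (Ring.choose (k - 1) j : ℤ)) •
          Φ v₁ (q + (k - 1) - j) (S₂.Y a (n + j) v₂)
        = Φ (S₁.zeroMode ha v₁) (q + n) v₂)}
  zero_mem' := by
    refine ⟨fun _ _ => ⟨0, fun _ _ => rfl⟩, fun v₁ n => ?_, fun k a ha v₁ v₂ n q => ?_⟩
    · ext; simp
    · simp
  add_mem' := by
    rintro Φ Ψ ⟨hΦ, hΦ', hΦ''⟩ ⟨hΨ, hΨ', hΨ''⟩
    refine ⟨fun v₁ v₂ => ?_, fun v₁ n => ?_, fun k a ha v₁ v₂ n q => ?_⟩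
    · obtain ⟨N, hN⟩ := hΦ v₁ v₂
      obtain ⟨N', hN'⟩ := hΨ v₁ v₂
      refine ⟨max N N', fun n hn => ?_⟩
      simp [hN n (le_trans (le_max_left _ _) hn), hN' n (le_trans (le_max_right _ _) hn)]
    · have h1 := hΦ' v₁ n
      have h2 := hΨ' v₁ n
      simp only [LinearMap.add_apply, Pi.add_apply, LinearMap.comp_add, LinearMap.add_comp,
        smul_add]
      rw [← h1, ← h2]; abel
    · have fin1 : ∀ X : S₁.gr 0 →ₗ[ℂ] (ℤ → (M₂ →ₗ[ℂ] M₃)), IsTruncated X →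
          (Function.support fun j : ℕ => ((-1 : ℂ) ^ j * (Ring.choose (k - 1) j : ℤ)) •
            S₃.Y a (n + (k - 1) - j) (X v₁ (q + j) v₂)).Finite := by
        intro X hX
        obtain ⟨N, hN⟩ := hX v₁ v₂
        refine finite_support_of_eventually_zero _ (N - q).toNat fun j hj => ?_
        rw [hN _ (by omega), map_zero, smul_zero]
      have fin2 : ∀ X : S₁.gr 0 →ₗ[ℂ] (ℤ → (M₂ →ₗ[ℂ] M₃)),
          (Function.support fun j : ℕ => ((-1 : ℂ) ^ (k - 1 - j) * (Ring.choose (k - 1) j : ℤ)) •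
            X v₁ (q + (k - 1) - j) (S₂.Y a (n + j) v₂)).Finite := by
        intro X
        obtain ⟨N, hN⟩ := S₂.truncation a v₂
        refine finite_support_of_eventually_zero _ (N - n).toNat fun j hj => ?_
        rw [hN _ (by omega), map_zero, smul_zero]
      simp only [LinearMap.add_apply, Pi.add_apply, map_add, smul_add]
      rw [finsum_add_distrib (fin1 Φ hΦ) (fin1 Ψ hΨ), finsum_add_distrib (fin2 Φ) (fin2 Ψ),
        ← hΦ'' k a ha v₁ v₂ n q, ← hΨ'' k a ha v₁ v₂ n q]
      abel
  smul_mem' := by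
    rintro c Φ ⟨hΦ, hΦ', hΦ''⟩
    refine ⟨fun v₁ v₂ => ?_, fun v₁ n => ?_, fun k a ha v₁ v₂ n q => ?_⟩
    · obtain ⟨N, hN⟩ := hΦ v₁ v₂
      exact ⟨N, fun n hn => by simp [hN n hn]⟩
    · simp only [LinearMap.smul_apply, Pi.smul_apply, LinearMap.comp_smul, LinearMap.smul_comp]
      rw [← smul_sub, hΦ' v₁ n, smul_comm]
    · simp only [LinearMap.smul_apply, Pi.smul_apply, map_smul]
      rw [← hΦ'' k a ha v₁ v₂ n q, smul_sub, smul_finsum, smul_finsum]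
      simp only [smul_comm c]

end

/-! Everything reduces to matrix coefficients between homogeneous vectors. Each `M³(n)` is
finite-dimensional, so reflexivity makes a functional `F` on `(M³)' ⊗ M¹(0) ⊗ M²` the same thing as
a family of modes with `v₁(n) M²(d) ⊆ M³(d-n-1)`; the relation is `HasModes`. It remains to match
the conditions on the two sides.

Jacobi identity: the operator `a'(n)` on `(M³)'` is the transpose of `a(n)`
(`pairing_dualOppositeMode`). Hence a coefficient of the restricted Jacobi identity, paired with
vectors of degrees `m` and `d`, is zero for degree reasons unless `q = d-m-n-1`. In that case it is,
up to sign, the value of `F` on the action of `a ⊗ z^n (z-1)^(wt a - 1)`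
(`HasModes.pairing_jacobi`). Relations with a larger power of `z-1` follow from these
(`restrictedChiralAction_succ`).

Derivative property: the Jacobi identity for `ω` relates `[L(-1), v₁(n+1)]` to `L(0)`, so given
Jacobi the derivative property says exactly that `v₁(n)` shifts degrees by `-n-1`
(`derivative_iff_mem_gr`). Modes built from a functional do so by construction, and truncation
follows.

Dependence on `w`: multiplication by `w^(deg v₃' - deg v₂)` intertwines the actions at `w` and at
`1` up to nonzero scalars (`restrictedChiralAction_comp_tensorScale`). -/

noncomputable section

/-! ### Graded linear algebra on a module and its contragredient. -/

namespace OrdinaryModule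

variable {V : Type*} [AddCommGroup V] [Module ℂ V] {A : VertexOperatorAlgebra V}
variable {M : Type*} [AddCommGroup M] [Module ℂ M] (S : OrdinaryModule A M)
variable {N : Type*} [AddCommGroup N] [Module ℂ N]

lemma homogeneous_induction {P : M → Prop} (zero : P 0) (hom : ∀ d, ∀ u ∈ S.gr d, P u)
    (hadd : ∀ x y, P x → P y → P (x + y)) (u : M) : P u := by
  have hu : u ∈ (⨆ i, S.gr i) := by
    rw [S.isInternal.submodule_iSup_eq_top]; trivial
  induction hu using Submodule.iSup_induction' with
  | mem i x hx => exact hom i x hx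
  | zero => exact zero
  | add x y _ _ hx hy => exact hadd x y hx hy

lemma hom_ext {f g : M →ₗ[ℂ] N} (h : ∀ d, ∀ u ∈ S.gr d, f u = g u) : f = g :=
  LinearMap.ext fun u => S.homogeneous_induction (P := fun u => f u = g u) (by simp) h
    (fun x y hx hy => by simp only [map_add, hx, hy]) u

/-- The identification of `M` with the direct sum of its graded pieces. -/
def grEquiv : (DirectSum ℤ fun i => S.gr i) ≃ₗ[ℂ] M :=
  LinearEquiv.ofBijective (DirectSum.coeLinearMap S.gr) S.isInternal

lemma grEquiv_symm_of_mem {d : ℤ} {u : M} (hu : u ∈ S.gr d) :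
    S.grEquiv.symm u = DirectSum.lof ℂ ℤ (fun i => S.gr i) d ⟨u, hu⟩ := by
  rw [LinearEquiv.symm_apply_eq]
  exact (DirectSum.coeLinearMap_lof S.gr d ⟨u, hu⟩).symm

/-- The linear map on `M` with prescribed restrictions to the graded pieces. -/
def lift (T : ∀ d, S.gr d →ₗ[ℂ] N) : M →ₗ[ℂ] N :=
  DirectSum.toModule ℂ ℤ N T ∘ₗ S.grEquiv.symm.toLinearMap

lemma lift_of_mem (T : ∀ d, S.gr d →ₗ[ℂ] N) {d : ℤ} {u : M} (hu : u ∈ S.gr d) :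
    S.lift T u = T d ⟨u, hu⟩ := by
  simp [lift, S.grEquiv_symm_of_mem hu]

/-- The projection of `M` onto `M(i)`. -/
def proj (i : ℤ) : M →ₗ[ℂ] S.gr i :=
  DirectSum.component ℂ ℤ (fun i => S.gr i) i ∘ₗ S.grEquiv.symm.toLinearMap

lemma proj_of_mem {i : ℤ} {u : M} (hu : u ∈ S.gr i) : S.proj i u = ⟨u, hu⟩ := by
  simp [proj, S.grEquiv_symm_of_mem hu, DirectSum.component.lof_self]

lemma proj_of_ne {d i : ℤ} (hdi : d ≠ i) {u : M} (hu : u ∈ S.gr d) : S.proj i u = 0 := by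
  simp only [proj, LinearMap.comp_apply, LinearEquiv.coe_coe, S.grEquiv_symm_of_mem hu]
  rw [DirectSum.component.of, dif_neg hdi]

lemma mem_gr_of_proj {n : ℤ} {u : M} (h : ∀ i ≠ n, S.proj i u = 0) : u ∈ S.gr n := by
  have e : S.grEquiv.symm u = DirectSum.lof ℂ ℤ (fun i => S.gr i) n (S.proj n u) := by
    refine DirectSum.ext_component ℂ fun i => ?_
    by_cases hi : i = n
    · subst hi; rw [DirectSum.component.lof_self]; rfl
    · rw [DirectSum.component.of, dif_neg (Ne.symm hi)]; exact h i hi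
  rw [LinearEquiv.symm_apply_eq] at e
  rw [e]
  exact (DirectSum.coeLinearMap_lof S.gr n (S.proj n u)).symm ▸ (S.proj n u).2

lemma eq_zero_of_proj {u : M} (h : ∀ i, S.proj i u = 0) : u = 0 := by
  rw [← S.grEquiv.symm.map_eq_zero_iff]
  exact DirectSum.ext_component ℂ fun i => (h i).trans (map_zero _).symm

/-- The eigenvalues `h + i` for integers `i` are pairwise distinct: projecting the eigenvector
equation to `M(i)` leaves `n - i` times the component. -/
lemma mem_gr_of_L0_eigen {n : ℤ} {u : M} (hu : S.Y A.omega 1 u = (S.h + n) • u) :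
    u ∈ S.gr n := by
  have key : ∀ i : ℤ, S.proj i ∘ₗ S.Y A.omega 1 = (S.h + i) • S.proj i := fun i =>
    S.hom_ext fun d v hv => by
      rw [LinearMap.comp_apply, S.L0_eigen d v hv, map_smul, LinearMap.smul_apply]
      by_cases hd : d = i
      · rw [hd]
      · rw [S.proj_of_ne hd hv, smul_zero, smul_zero]
  refine S.mem_gr_of_proj fun i hi => ?_
  have h1 := LinearMap.congr_fun (key i) u
  rw [LinearMap.comp_apply, hu, map_smul, LinearMap.smul_apply, ← sub_eq_zero, ← sub_smul] at h1
  refine (smul_eq_zero.mp h1).resolve_left fun h2 => hi ?_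
  have h3 : ((n - i : ℤ) : ℂ) = 0 := by push_cast; linear_combination h2
  have := Int.cast_eq_zero.mp h3
  omega

lemma contragredient_ext {f g : S.Contragredient} (h : ∀ u, S.pairing f u = S.pairing g u) :
    f = g :=
  Subtype.ext (LinearMap.ext h)

/-- The inclusion of `M(m)^*` in the contragredient module, by extension by zero. -/
def dualInclusion (m : ℤ) : Module.Dual ℂ (S.gr m) →ₗ[ℂ] S.Contragredient :=
  LinearMap.codRestrict S.gradedDual (S.proj m).dualMap fun g =>
    ⟨m + 1, fun i hi u hu => by
      rw [LinearMap.dualMap_apply, S.proj_of_ne (by omega) hu, map_zero]⟩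

lemma pairing_dualInclusion (m : ℤ) (g : Module.Dual ℂ (S.gr m)) (u : M) :
    S.pairing (S.dualInclusion m g) u = g (S.proj m u) := rfl

lemma dualInclusion_mem (m : ℤ) (g : Module.Dual ℂ (S.gr m)) :
    S.dualInclusion m g ∈ S.dualGr m := fun i hi u hu => by
  rw [pairing_dualInclusion, S.proj_of_ne hi hu, map_zero]

lemma dualInclusion_restrict {m : ℤ} {f : S.Contragredient} (hf : f ∈ S.dualGr m) :
    S.dualInclusion m (S.pairing f ∘ₗ (S.gr m).subtype) = f := by
  refine S.contragredient_ext fun u => LinearMap.congr_fun (S.hom_ext fun d v hv => ?_) u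
  rw [pairing_dualInclusion]
  by_cases hd : d = m
  · subst hd
    rw [S.proj_of_mem hv]; rfl
  · rw [S.proj_of_ne hd hv, map_zero, hf d hd v hv]

lemma eq_zero_of_pairing {u : M} (h : ∀ m, ∀ f ∈ S.dualGr m, S.pairing f u = 0) : u = 0 :=
  S.eq_zero_of_proj fun i => (Module.forall_dual_apply_eq_zero_iff ℂ _).mp fun g =>
    h i _ (S.dualInclusion_mem i g)

lemma dual_homogeneous_induction {P : S.Contragredient → Prop} (zero : P 0)
    (hom : ∀ m, ∀ f ∈ S.dualGr m, P f) (hadd : ∀ f g, P f → P g → P (f + g))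
    (f : S.Contragredient) : P f := by
  obtain ⟨K, hK⟩ := f.2
  -- The functional vanishes in degrees at least `K` and the module in negative degrees, so finitely
  -- many restrictions recover it.
  have e : f = ∑ m ∈ Finset.Ico 0 K, S.dualInclusion m (S.pairing f ∘ₗ (S.gr m).subtype) := by
    refine S.contragredient_ext fun u => LinearMap.congr_fun (S.hom_ext fun d v hv => ?_) u
    rw [map_sum, LinearMap.sum_apply]
    simp only [pairing_dualInclusion]
    rw [Finset.sum_eq_single d (fun i _ hi => by rw [S.proj_of_ne hi.symm hv, map_zero])]
    · rw [S.proj_of_mem hv]; rfl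
    · intro hd
      rw [S.proj_of_mem hv]
      by_cases h0 : d < 0
      · have hv' := hv
        rw [S.gr_neg d h0, Submodule.mem_bot] at hv'
        subst hv'; exact map_zero _
      · exact hK d (by simpa [not_lt.mp h0] using hd) v hv
  rw [e]
  exact Finset.sum_induction _ P hadd zero fun m _ => hom m _ (S.dualInclusion_mem m _)

end OrdinaryModule

/-! ### Opposite modes as transposes. -/

lemma VertexOperatorAlgebra.exists_L1_pow_eq_zero {V : Type*} [AddCommGroup V] [Module ℂ V]
    (A : VertexOperatorAlgebra V) {k : ℤ} {a : V} (ha : a ∈ A.gr k) :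
    ∃ J : ℕ, ∀ j ≥ J, (A.L1 ^ j) a = 0 := by
  obtain ⟨N, hN⟩ := A.boundedBelow
  refine ⟨(k - N + 1).toNat, fun j hj => ?_⟩
  have h := A.L1_pow_mem ha j
  rwa [hN _ (by omega), Submodule.mem_bot] at h

lemma finsum_eq_sum_range_of_eventually_zero {E : Type*} [AddCommMonoid E] {f : ℕ → E} {N : ℕ}
    (h : ∀ j ≥ N, f j = 0) : ∑ᶠ j, f j = ∑ j ∈ Finset.range N, f j :=
  finsum_eq_sum_of_support_subset _ fun j hj => by
    rw [Finset.coe_range, Set.mem_Iio]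
    by_contra hc
    exact hj (h j (not_lt.mp hc))

/-- This is the coefficient of `x^m` in `e^(-x) e^x = 1`. -/
lemma sum_range_neg_one_pow_div_factorial (m : ℕ) :
    ∑ i ∈ Finset.range (m + 1), (-1 : ℂ) ^ i / (i.factorial * (m - i).factorial)
      = if m = 0 then 1 else 0 := by
  have h := congrArg (fun x : ℤ => (x : ℂ)) (Int.alternating_sum_range_choose (n := m))
  have hm : (m.factorial : ℂ) ≠ 0 := by exact_mod_cast m.factorial_ne_zero
  have e : ∑ i ∈ Finset.range (m + 1), (-1 : ℂ) ^ i / (i.factorial * (m - i).factorial)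
      = (∑ i ∈ Finset.range (m + 1), (-1 : ℂ) ^ i * m.choose i) / m.factorial := by
    rw [Finset.sum_div]
    refine Finset.sum_congr rfl fun i hi => ?_
    rw [Nat.cast_choose ℂ (Nat.lt_succ_iff.mp (Finset.mem_range.mp hi))]
    field_simp
  push_cast at h
  rw [e, h]
  split_ifs with h0
  · subst h0; simp
  · simp

namespace OrdinaryModule

variable {V : Type*} [AddCommGroup V] [Module ℂ V] {A : VertexOperatorAlgebra V}
variable {M : Type*} [AddCommGroup M] [Module ℂ M] (S : OrdinaryModule A M)

lemma oppositeMode_eq_sum {k : ℤ} {a : V} {J : ℕ} (hJ : ∀ j ≥ J, (A.L1 ^ j) a = 0) (n : ℤ) :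
    S.oppositeMode k a n = ∑ j ∈ Finset.range J,
      ((-1 : ℂ) ^ k / (j.factorial : ℂ)) • S.Y ((A.L1 ^ j) a) (2 * k - n - j - 2) :=
  finsum_eq_sum_range_of_eventually_zero fun j hj => by
    rw [hJ j hj, map_zero, Pi.zero_apply, smul_zero]

lemma pairing_dualMode {k : ℤ} {a : V} (ha : a ∈ A.gr k) (n : ℤ) (f : S.Contragredient) (u : M) :
    S.pairing (S.dualMode ha n f) u = S.pairing f (S.oppositeMode k a n u) := rfl

lemma dualOppositeMode_eq_sum {k : ℤ} {a : V} (ha : a ∈ A.gr k) {J : ℕ}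
    (hJ : ∀ j ≥ J, (A.L1 ^ j) a = 0) (n : ℤ) :
    S.dualOppositeMode ha n = ∑ j ∈ Finset.range J, ((-1 : ℂ) ^ k / (j.factorial : ℂ)) •
      S.dualMode (A.L1_pow_mem ha j) (2 * k - n - j - 2) := by
  refine finsum_eq_sum_range_of_eventually_zero fun j hj => ?_
  refine smul_eq_zero_of_right _ (LinearMap.ext fun f => S.contragredient_ext fun u => ?_)
  rw [pairing_dualMode, S.oppositeMode_eq_sum (J := 0) (fun i _ => by rw [hJ j hj, map_zero])]
  simp

/-- The operator `a'(n)` is the transpose of `a(n)`. -/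
lemma pairing_dualOppositeMode {k : ℤ} {a : V} (ha : a ∈ A.gr k) (n : ℤ) (f : S.Contragredient)
    (u : M) : S.pairing (S.dualOppositeMode ha n f) u = S.pairing f (S.Y a n u) := by
  -- The bound is a successor so that the one surviving term, `m = 0`, lies in the range of
  -- summation.
  obtain ⟨J, hJ⟩ : ∃ J : ℕ, ∀ j ≥ J + 1, (A.L1 ^ j) a = 0 := by
    obtain ⟨J, hJ⟩ := A.exists_L1_pow_eq_zero ha
    exact ⟨J, fun j hj => hJ j (by omega)⟩
  -- Expanding both nested opposite modes gives a double sum over `j` and `i` whose terms depend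
  -- only on `s = j + i`, apart from the coefficient `(-1)^j / (j! i!)`. Summing along diagonals
  -- then kills every `s > 0`.
  set g : ℕ → ℂ := fun s => S.pairing f (S.Y ((A.L1 ^ s) a) (n - s) u) with hg
  have inner : ∀ j : ℕ, ((-1 : ℂ) ^ k / (j.factorial : ℂ)) *
      S.pairing f (S.oppositeMode (k - j) ((A.L1 ^ j) a) (2 * k - n - j - 2) u)
      = ∑ i ∈ Finset.range (J + 1 - j),
        (-1 : ℂ) ^ j / (j.factorial * i.factorial) * g (j + i) := by
    intro j
    rw [S.oppositeMode_eq_sum (J := J + 1 - j) (fun i hi => by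
      rw [← Module.End.mul_apply, ← pow_add]; exact hJ _ (by omega))]
    rw [LinearMap.sum_apply, map_sum, Finset.mul_sum]
    refine Finset.sum_congr rfl fun i _ => ?_
    rw [LinearMap.smul_apply, map_smul, smul_eq_mul, ← Module.End.mul_apply (A.L1 ^ i), ← pow_add,
      hg]
    have e1 : 2 * (k - (j : ℤ)) - (2 * k - n - j - 2) - i - 2 = n - ((j + i : ℕ) : ℤ) := by
      push_cast; ring
    have e2 : (-1 : ℂ) ^ k * (-1 : ℂ) ^ (k - (j : ℤ)) = (-1 : ℂ) ^ j := by
      rw [← zpow_add₀ (by norm_num), show k + (k - (j : ℤ)) = 2 * (k - j) + j by ring,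
        zpow_add₀ (by norm_num), zpow_mul]
      norm_num
    rw [e1, add_comm i j]
    rw [← e2]
    field_simp
  rw [S.dualOppositeMode_eq_sum ha hJ, LinearMap.sum_apply, map_sum, LinearMap.sum_apply]
  simp only [LinearMap.smul_apply, map_smul, smul_eq_mul, pairing_dualMode, inner]
  rw [← Finset.sum_range_diag_flip (J + 1)
    (fun j i => (-1 : ℂ) ^ j / (j.factorial * i.factorial) * g (j + i))]
  have diag : ∀ m ∈ Finset.range (J + 1), ∑ j ∈ Finset.range (m + 1),
      (-1 : ℂ) ^ j / (j.factorial * (m - j).factorial) * g (j + (m - j))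
      = if m = 0 then g m else 0 := by
    intro m _
    rw [← boole_mul, ← sum_range_neg_one_pow_div_factorial m, Finset.sum_mul]
    refine Finset.sum_congr rfl fun j hj => ?_
    rw [Nat.add_sub_cancel' (Nat.lt_succ_iff.mp (Finset.mem_range.mp hj))]
  rw [Finset.sum_congr rfl diag]
  simp [hg]

lemma dualOppositeMode_mem {k : ℤ} {a : V} (ha : a ∈ A.gr k) (n : ℤ) {m : ℤ}
    {f : S.Contragredient} (hf : f ∈ S.dualGr m) :
    S.dualOppositeMode ha n f ∈ S.dualGr (m - k + n + 1) := fun i hi u hu => by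
  rw [pairing_dualOppositeMode]
  exact hf _ (by omega) _ (S.grading k n i a ha u hu)

end OrdinaryModule

/-! ### Raising the power of `z - w`. -/

lemma finsum_choose_succ {E : Type*} [AddCommGroup E] [Module ℂ E] (p : ℤ) {g : ℕ → E} {N : ℕ}
    (hg : ∀ j ≥ N, g j = 0) :
    ∑ᶠ j : ℕ, ((Ring.choose (p + 1) j : ℤ) : ℂ) • g j
      = ∑ᶠ j : ℕ, ((Ring.choose p j : ℤ) : ℂ) • g j
        + ∑ᶠ j : ℕ, ((Ring.choose p j : ℤ) : ℂ) • g (j + 1) := by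
  have h1 : ∀ r : ℤ, ∀ j ≥ N + 1, ((Ring.choose r j : ℤ) : ℂ) • g j = 0 := fun r j hj => by
    rw [hg j (by omega), smul_zero]
  have h2 : ∀ j ≥ N, ((Ring.choose p j : ℤ) : ℂ) • g (j + 1) = 0 := fun j hj => by
    rw [hg _ (by omega), smul_zero]
  rw [finsum_eq_sum_range_of_eventually_zero (h1 (p + 1)),
    finsum_eq_sum_range_of_eventually_zero (h1 p), finsum_eq_sum_range_of_eventually_zero h2,
    Finset.sum_range_succ', Finset.sum_range_succ' _ N]
  simp only [Ring.choose_succ_succ, Int.cast_add, add_smul, Finset.sum_add_distrib,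
    Ring.choose_zero_right]
  abel

namespace OrdinaryModule

variable {V : Type*} [AddCommGroup V] [Module ℂ V] {A : VertexOperatorAlgebra V}
variable {M : Type*} [AddCommGroup M] [Module ℂ M] (S : OrdinaryModule A M)

lemma rhoInfty_apply (w : ℂ) {k : ℤ} {a : V} (ha : a ∈ A.gr k) (n p : ℤ) (f : S.Contragredient) :
    S.rhoInfty w ha n p f = -∑ᶠ j : ℕ, ((Ring.choose p j : ℤ) * (-w) ^ j : ℂ) •
      S.dualOppositeMode ha (n + p - j) f := rfl

lemma rhoZero_apply (w : ℂ) (a : V) (n p : ℤ) (u : M) :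
    S.rhoZero w a n p u = ∑ᶠ j : ℕ, ((Ring.choose p j : ℤ) * (-w) ^ (p - j) : ℂ) •
      S.Y a (n + j) u := rfl

/-- Modes of index above `wt a - 1` lower the degree and so kill `M(0)`; only the term `j = 0` with
`p = wt a - 1` can survive. -/
lemma rhoWBottom_eq (w : ℂ) {k : ℤ} {a : V} (ha : a ∈ A.gr k) (n : ℤ) {p : ℤ} (hp : k - 1 ≤ p) :
    S.rhoWBottom w ha n hp = if p = k - 1 then w ^ n • S.zeroMode ha else 0 := by
  have hz : ∀ (v : S.gr 0) (q : ℤ), k - 1 < q → S.Y a q v = 0 := fun v q hq => by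
    have h := S.grading k q 0 a ha v v.2
    rwa [S.gr_neg _ (by omega), Submodule.mem_bot] at h
  ext v
  change ∑ᶠ j : ℕ, ((Ring.choose n j : ℤ) * w ^ (n - j) : ℂ) • S.Y a (p + j) (v : M) = _
  split_ifs with h
  · subst h
    rw [finsum_eq_single _ 0 fun j hj => by rw [hz v _ (by omega), smul_zero]]
    simp [zeroMode]
  · exact (finsum_congr fun j => by rw [hz v _ (by omega), smul_zero]).trans finsum_zero

/-- The expansion at infinity of `z^n (z-w)^(p+1) = z^(n+1) (z-w)^p - w z^n (z-w)^p`, obtained from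
Pascal's rule. The next two lemmas with suffix `_succ` treat the expansions at `0` and at `w`. -/
lemma rhoInfty_succ (w : ℂ) {k : ℤ} {a : V} (ha : a ∈ A.gr k) (n p : ℤ) :
    S.rhoInfty w ha n (p + 1) = S.rhoInfty w ha (n + 1) p - w • S.rhoInfty w ha n p := by
  refine LinearMap.ext fun f => ?_
  obtain ⟨N, hN⟩ := S.dualOppositeMode_truncation ha f
  rw [LinearMap.sub_apply, LinearMap.smul_apply]
  simp only [rhoInfty_apply, mul_smul]
  rw [finsum_choose_succ (N := (n + (p + 1) - N).toNat) p fun j hj => by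
      rw [hN _ (by omega), smul_zero], neg_add, smul_neg, sub_neg_eq_add, smul_finsum,
    ← finsum_neg_distrib (f := fun j : ℕ => ((Ring.choose p j : ℤ) : ℂ) • (-w) ^ (j + 1) • _)]
  congr 1
  · refine congrArg _ (finsum_congr fun j => ?_)
    rw [show n + (p + 1) - (j : ℤ) = n + 1 + p - j by ring]
  · refine finsum_congr fun j => ?_
    rw [show n + (p + 1) - ((j + 1 : ℕ) : ℤ) = n + p - j by push_cast; ring]
    simp only [smul_smul, ← neg_smul]
    congr 1
    ring

lemma rhoZero_succ {w : ℂ} (hw : w ≠ 0) (a : V) (n p : ℤ) :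
    S.rhoZero w a n (p + 1) = S.rhoZero w a (n + 1) p - w • S.rhoZero w a n p := by
  refine LinearMap.ext fun u => ?_
  obtain ⟨N, hN⟩ := S.truncation a u
  have hw' : -w ≠ 0 := neg_ne_zero.mpr hw
  rw [LinearMap.sub_apply, LinearMap.smul_apply]
  simp only [rhoZero_apply, mul_smul]
  -- Compared with infinity the two sums swap roles: the shifted one carries the modes for `n + 1`,
  -- the unshifted one the extra factor `-w`.
  rw [finsum_choose_succ (N := (N - n).toNat) p fun j hj => by
      rw [hN _ (by omega), smul_zero], add_comm, sub_eq_add_neg, ← neg_smul, smul_finsum]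
  congr 1
  · refine finsum_congr fun j => ?_
    rw [show n + ((j + 1 : ℕ) : ℤ) = n + 1 + j by push_cast; ring,
      show p + 1 - ((j + 1 : ℕ) : ℤ) = p - j by push_cast; ring]
  · refine finsum_congr fun j => ?_
    rw [show p + 1 - (j : ℤ) = p - j + 1 by ring, zpow_add_one₀ hw']
    simp only [smul_smul]
    congr 1
    ring

lemma rhoWBottom_succ {w : ℂ} (hw : w ≠ 0) {k : ℤ} {a : V} (ha : a ∈ A.gr k) (n : ℤ) {p : ℤ}
    (hp : k - 1 ≤ p) :
    S.rhoWBottom w ha n (hp.trans (Int.le_add_one le_rfl))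
      = S.rhoWBottom w ha (n + 1) hp - w • S.rhoWBottom w ha n hp := by
  simp only [rhoWBottom_eq]
  rw [if_neg (by omega)]
  split_ifs
  · rw [zpow_add_one₀ hw, smul_smul, mul_comm, sub_self]
  · simp

/-! ### Rescaling by degree and its effect on the local actions. -/

/-- The operator on `M` acting as `u ^ d` on `M(d)`. -/
def scale (u : ℂ) : Module.End ℂ M :=
  S.lift fun d => u ^ d • (S.gr d).subtype

lemma scale_of_mem (u : ℂ) {d : ℤ} {v : M} (hv : v ∈ S.gr d) : S.scale u v = u ^ d • v :=
  S.lift_of_mem _ hv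

/-- The operator on the contragredient module acting as `u ^ m` on `M(m)^*`. -/
def dualScale (u : ℂ) : Module.End ℂ S.Contragredient :=
  (S.scale u).dualMap.restrict fun f hf => by
    obtain ⟨N, hN⟩ := hf
    refine ⟨N, fun m hm v hv => ?_⟩
    rw [LinearMap.dualMap_apply, S.scale_of_mem u hv, map_smul, hN m hm v hv, smul_zero]

lemma pairing_dualScale (u : ℂ) (f : S.Contragredient) (v : M) :
    S.pairing (S.dualScale u f) v = S.pairing f (S.scale u v) := rfl

lemma dualScale_of_mem (u : ℂ) {m : ℤ} {f : S.Contragredient} (hf : f ∈ S.dualGr m) :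
    S.dualScale u f = u ^ m • f := by
  refine S.contragredient_ext fun v => LinearMap.congr_fun (S.hom_ext fun d v hv => ?_) v
  rw [pairing_dualScale, S.scale_of_mem u hv, map_smul, map_smul, LinearMap.smul_apply]
  by_cases hd : d = m
  · rw [hd]
  · rw [hf d hd v hv, smul_zero, smul_zero]

/-- The `j`-th term sends degree `m` to `m - k + n + p - j + 1`, and the `j`-dependence of this
shift cancels against `(-ux)^j = u^j (-x)^j`. The same leftover `u^(k-1-n-p)` appears at `0` and at
`w`, which is what lets the three actions be added. -/
lemma rhoInfty_dualScale {u : ℂ} (hu : u ≠ 0) (x : ℂ) {k : ℤ} {a : V} (ha : a ∈ A.gr k) (n p : ℤ)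
    {m : ℤ} {f : S.Contragredient} (hf : f ∈ S.dualGr m) :
    u ^ m • S.rhoInfty x ha n p f
      = u ^ (k - 1 - n - p) • S.dualScale u (S.rhoInfty (u * x) ha n p f) := by
  obtain ⟨N, hN⟩ := S.dualOppositeMode_truncation ha f
  have hs : ∀ y : ℂ, ∀ j ≥ (n + p - N).toNat, ((Ring.choose p j : ℤ) * (-y) ^ j : ℂ) •
      S.dualOppositeMode ha (n + p - j) f = 0 := fun y j hj => by
    rw [hN _ (by omega), smul_zero]
  rw [rhoInfty_apply, rhoInfty_apply, finsum_eq_sum_range_of_eventually_zero (hs x),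
    finsum_eq_sum_range_of_eventually_zero (hs (u * x)), map_neg, smul_neg, smul_neg, map_sum,
    Finset.smul_sum, Finset.smul_sum]
  refine congrArg _ (Finset.sum_congr rfl fun j _ => ?_)
  rw [map_smul, S.dualScale_of_mem u (S.dualOppositeMode_mem ha (n + p - j) hf)]
  simp only [smul_smul]
  congr 1
  rw [show -(u * x) = u * -x by ring, mul_pow]
  have e : u ^ m = u ^ (k - 1 - n - p) * u ^ j * u ^ (m - k + (n + p - j) + 1) := by
    rw [← zpow_natCast, ← zpow_add₀ hu, ← zpow_add₀ hu]; congr 1; ring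
  rw [e]; ring

lemma rhoZero_scale {u : ℂ} (hu : u ≠ 0) (x : ℂ) {k : ℤ} {a : V} (ha : a ∈ A.gr k) (n p : ℤ)
    {d : ℤ} {v : M} (hv : v ∈ S.gr d) :
    u⁻¹ ^ d • S.rhoZero x a n p v
      = u ^ (k - 1 - n - p) • S.scale u⁻¹ (S.rhoZero (u * x) a n p v) := by
  obtain ⟨N, hN⟩ := S.truncation a v
  have hs : ∀ y : ℂ, ∀ j ≥ (N - n).toNat, ((Ring.choose p j : ℤ) * (-y) ^ (p - j) : ℂ) •
      S.Y a (n + j) v = 0 := fun y j hj => by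
    rw [hN _ (by omega), smul_zero]
  rw [rhoZero_apply, rhoZero_apply, finsum_eq_sum_range_of_eventually_zero (hs x),
    finsum_eq_sum_range_of_eventually_zero (hs (u * x)), map_sum,
    Finset.smul_sum, Finset.smul_sum]
  refine Finset.sum_congr rfl fun j _ => ?_
  rw [map_smul, S.scale_of_mem _ (S.grading k (n + j) d a ha v hv)]
  simp only [smul_smul]
  congr 1
  rw [show -(u * x) = u * -x by ring, mul_zpow]
  have e : u⁻¹ ^ d
      = u ^ (k - 1 - n - p) * u ^ (p - j) * u⁻¹ ^ (d + k - (n + j) - 1) := by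
    rw [inv_zpow', inv_zpow', ← zpow_add₀ hu, ← zpow_add₀ hu]; congr 1; ring
  rw [e]; ring

lemma rhoWBottom_scale {u : ℂ} (hu : u ≠ 0) (x : ℂ) {k : ℤ} {a : V} (ha : a ∈ A.gr k) (n : ℤ)
    {p : ℤ} (hp : k - 1 ≤ p) :
    S.rhoWBottom x ha n hp = u ^ (k - 1 - n - p) • S.rhoWBottom (u * x) ha n hp := by
  rw [rhoWBottom_eq, rhoWBottom_eq]
  split_ifs with h
  · rw [smul_smul, mul_zpow, ← mul_assoc, ← zpow_add₀ hu, h,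
      show k - 1 - n - (k - 1) + n = 0 by ring, zpow_zero, one_mul]
  · simp

end OrdinaryModule

/-! ### The action on the tensor product, and the comparison of blocks at `1` and at `w`. -/

section Blocks

variable {V : Type*} [AddCommGroup V] [Module ℂ V] {A : VertexOperatorAlgebra V}
  {M₁ M₂ M₃ : Type*} [AddCommGroup M₁] [Module ℂ M₁] [AddCommGroup M₂] [Module ℂ M₂]
  [AddCommGroup M₃] [Module ℂ M₃] (S₁ : OrdinaryModule A M₁) (S₂ : OrdinaryModule A M₂)
  (S₃ : OrdinaryModule A M₃)

lemma restrictedChiralAction_tmul (w : ℂ) {k : ℤ} {a : V} (ha : a ∈ A.gr k) (n : ℤ) {p : ℤ}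
    (hp : k - 1 ≤ p) (f : S₃.Contragredient) (v₁ : S₁.gr 0) (v₂ : M₂) :
    restrictedChiralAction S₁ S₂ S₃ w ha n hp (f ⊗ₜ (v₁ ⊗ₜ v₂))
      = S₃.rhoInfty w ha n p f ⊗ₜ (v₁ ⊗ₜ v₂) + f ⊗ₜ (S₁.rhoWBottom w ha n hp v₁ ⊗ₜ v₂)
        + f ⊗ₜ (v₁ ⊗ₜ S₂.rhoZero w a n p v₂) := rfl

/-- Linear maps on `(M³)' ⊗ M¹(0) ⊗ M²` are determined by homogeneous pure tensors. -/
lemma tensor_hom_ext {N : Type*} [AddCommGroup N] [Module ℂ N]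
    {F G : S₃.Contragredient ⊗[ℂ] (S₁.gr 0 ⊗[ℂ] M₂) →ₗ[ℂ] N}
    (h : ∀ m, ∀ f ∈ S₃.dualGr m, ∀ v₁ : S₁.gr 0, ∀ d, ∀ v₂ ∈ S₂.gr d,
      F (f ⊗ₜ (v₁ ⊗ₜ v₂)) = G (f ⊗ₜ (v₁ ⊗ₜ v₂))) : F = G := by
  refine TensorProduct.ext (LinearMap.ext fun f => TensorProduct.ext (LinearMap.ext fun v₁ =>
    S₂.hom_ext fun d v₂ hv => ?_))
  change F (f ⊗ₜ (v₁ ⊗ₜ v₂)) = G (f ⊗ₜ (v₁ ⊗ₜ v₂))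
  refine S₃.dual_homogeneous_induction
    (P := fun f => F (f ⊗ₜ (v₁ ⊗ₜ v₂)) = G (f ⊗ₜ (v₁ ⊗ₜ v₂))) (by simp)
    (fun m f hf => h m f hf v₁ d v₂ hv) (fun f g hf hg => ?_) f
  simp only [TensorProduct.add_tmul, map_add, hf, hg]

lemma restrictedChiralAction_succ {w : ℂ} (hw : w ≠ 0) {k : ℤ} {a : V} (ha : a ∈ A.gr k) (n : ℤ)
    {p : ℤ} (hp : k - 1 ≤ p) :
    restrictedChiralAction S₁ S₂ S₃ w ha n (hp.trans (Int.le_add_one le_rfl))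
      = restrictedChiralAction S₁ S₂ S₃ w ha (n + 1) hp
        - w • restrictedChiralAction S₁ S₂ S₃ w ha n hp := by
  refine tensor_hom_ext S₁ S₂ S₃ fun m f _ v₁ d v₂ _ => ?_
  rw [LinearMap.sub_apply, LinearMap.smul_apply]
  simp only [restrictedChiralAction_tmul]
  rw [S₃.rhoInfty_succ, S₁.rhoWBottom_succ hw ha n hp, S₂.rhoZero_succ hw]
  simp only [LinearMap.sub_apply, LinearMap.smul_apply, TensorProduct.sub_tmul,
    TensorProduct.tmul_sub, ← TensorProduct.smul_tmul', TensorProduct.tmul_smul, smul_add]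
  abel

/-- A functional vanishes on the image of the restricted chiral Lie algebra as soon as it vanishes
on the images of homogeneous pure tensors under the `a ⊗ z^n (z-w)^{wt a-1}`. -/
lemma vanishes_on_restrictedChiralImage {w : ℂ} (hw : w ≠ 0)
    {F : Module.Dual ℂ (S₃.Contragredient ⊗[ℂ] (S₁.gr 0 ⊗[ℂ] M₂))}
    (h : ∀ (k : ℤ) (a : V) (ha : a ∈ A.gr k) (n m : ℤ), ∀ f ∈ S₃.dualGr m, ∀ v₁ : S₁.gr 0,
      ∀ d, ∀ v₂ ∈ S₂.gr d,
      F (restrictedChiralAction S₁ S₂ S₃ w ha n le_rfl (f ⊗ₜ (v₁ ⊗ₜ v₂))) = 0) :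
    restrictedChiralImage S₁ S₂ S₃ w ≤ LinearMap.ker F := by
  -- Induction on `p` with `n` left general, since the recursion uses both `n` and `n + 1`.
  have key : ∀ (k : ℤ) (a : V) (ha : a ∈ A.gr k) (p : ℤ) (hp : k - 1 ≤ p) (n : ℤ),
      F ∘ₗ restrictedChiralAction S₁ S₂ S₃ w ha n hp = 0 := by
    intro k a ha p hp
    induction p, hp using Int.leInduction with
    | base =>
      intro n
      exact tensor_hom_ext S₁ S₂ S₃ fun m f hf v₁ d v₂ hv => h k a ha n m f hf v₁ d v₂ hv
    | succ p hp ih =>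
      intro n
      rw [restrictedChiralAction_succ S₁ S₂ S₃ hw ha n hp, LinearMap.comp_sub,
        LinearMap.comp_smul, ih, ih, smul_zero, sub_zero]
  refine Submodule.span_le.mpr ?_
  rintro _ ⟨k, a, ha, n, p, hp, t, rfl⟩
  exact LinearMap.congr_fun (key k a ha p hp n) t

/-- The operator on `(M³)' ⊗ M¹(0) ⊗ M²` multiplying by `u ^ (deg v₃' - deg v₂)`. -/
def tensorScale (u : ℂ) : Module.End ℂ (S₃.Contragredient ⊗[ℂ] (S₁.gr 0 ⊗[ℂ] M₂)) :=
  TensorProduct.map (S₃.dualScale u) (TensorProduct.map LinearMap.id (S₂.scale u⁻¹))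

lemma tensorScale_tmul {u : ℂ} (hu : u ≠ 0) {m d : ℤ} {f : S₃.Contragredient}
    (hf : f ∈ S₃.dualGr m) (v₁ : S₁.gr 0) {v₂ : M₂} (hv : v₂ ∈ S₂.gr d) :
    tensorScale S₁ S₂ S₃ u (f ⊗ₜ (v₁ ⊗ₜ v₂)) = u ^ (m - d) • f ⊗ₜ (v₁ ⊗ₜ v₂) := by
  simp only [tensorScale, TensorProduct.map_tmul, LinearMap.id_apply, S₃.dualScale_of_mem u hf,
    S₂.scale_of_mem _ hv, ← TensorProduct.smul_tmul', TensorProduct.tmul_smul, smul_smul]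
  rw [inv_zpow', ← zpow_add₀ hu, neg_add_eq_sub]

lemma tensorScale_comp_inv {u : ℂ} (hu : u ≠ 0) :
    tensorScale S₁ S₂ S₃ u ∘ₗ tensorScale S₁ S₂ S₃ u⁻¹ = LinearMap.id :=
  tensor_hom_ext S₁ S₂ S₃ fun m f hf v₁ d v₂ hv => by
    rw [LinearMap.comp_apply, tensorScale_tmul S₁ S₂ S₃ (inv_ne_zero hu) hf v₁ hv, map_smul,
      tensorScale_tmul S₁ S₂ S₃ hu hf v₁ hv, smul_smul, ← mul_zpow, inv_mul_cancel₀ hu, one_zpow,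
      one_smul, LinearMap.id_apply]

/-- The automorphism of `(M³)' ⊗ M¹(0) ⊗ M²` multiplying by `u ^ (deg v₃' - deg v₂)`. -/
def tensorScaleEquiv {u : ℂ} (hu : u ≠ 0) :
    (S₃.Contragredient ⊗[ℂ] (S₁.gr 0 ⊗[ℂ] M₂)) ≃ₗ[ℂ] (S₃.Contragredient ⊗[ℂ] (S₁.gr 0 ⊗[ℂ] M₂)) :=
  LinearEquiv.ofLinearMap (tensorScale S₁ S₂ S₃ u) (tensorScale S₁ S₂ S₃ u⁻¹)
    (tensorScale_comp_inv S₁ S₂ S₃ hu)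
    (by simpa using tensorScale_comp_inv S₁ S₂ S₃ (inv_ne_zero hu))

/-- Reflects the substitution `z ↦ uz`, which moves the puncture `x` to `ux`; all three summands
acquire the same power of `u`. -/
lemma restrictedChiralAction_comp_tensorScale {u : ℂ} (hu : u ≠ 0) (x : ℂ) {k : ℤ} {a : V}
    (ha : a ∈ A.gr k) (n : ℤ) {p : ℤ} (hp : k - 1 ≤ p) :
    restrictedChiralAction S₁ S₂ S₃ x ha n hp ∘ₗ tensorScale S₁ S₂ S₃ u
      = u ^ (k - 1 - n - p) •
        (tensorScale S₁ S₂ S₃ u ∘ₗ restrictedChiralAction S₁ S₂ S₃ (u * x) ha n hp) := by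
  refine tensor_hom_ext S₁ S₂ S₃ fun m f hf v₁ d v₂ hv => ?_
  have h1 := S₃.rhoInfty_dualScale hu x ha n p hf
  have h2 := S₂.rhoZero_scale hu x ha n p hv
  have h1' := congrArg (fun y => y ⊗ₜ[ℂ] (v₁ ⊗ₜ[ℂ] (u⁻¹ ^ d • v₂))) h1
  have h2' := congrArg (fun y => (u ^ m • f) ⊗ₜ[ℂ] (v₁ ⊗ₜ[ℂ] y)) h2
  rw [LinearMap.smul_apply, LinearMap.comp_apply, LinearMap.comp_apply]
  simp only [tensorScale, TensorProduct.map_tmul, LinearMap.id_apply, S₃.dualScale_of_mem u hf,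
    S₂.scale_of_mem u⁻¹ hv, restrictedChiralAction_tmul, map_smul, map_add,
    S₁.rhoWBottom_scale hu x ha n hp, LinearMap.smul_apply, smul_add,
    ← TensorProduct.smul_tmul', TensorProduct.tmul_smul, smul_smul, mul_comm] at h1' h2' ⊢
  rw [h1', h2']

lemma tensorScale_restrictedChiralImage_le {u : ℂ} (hu : u ≠ 0) (x : ℂ) :
    (restrictedChiralImage S₁ S₂ S₃ (u * x)).map (tensorScale S₁ S₂ S₃ u)
      ≤ restrictedChiralImage S₁ S₂ S₃ x := by
  rw [Submodule.map_le_iff_le_comap]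
  refine Submodule.span_le.mpr ?_
  rintro _ ⟨k, a, ha, n, p, hp, t, rfl⟩
  have h := LinearMap.congr_fun (restrictedChiralAction_comp_tensorScale S₁ S₂ S₃ hu x ha n hp) t
  rw [LinearMap.comp_apply, LinearMap.smul_apply, LinearMap.comp_apply,
    ← inv_smul_eq_iff₀ (zpow_ne_zero _ hu)] at h
  change tensorScale S₁ S₂ S₃ u _ ∈ restrictedChiralImage S₁ S₂ S₃ x
  rw [← h]
  exact Submodule.smul_mem _ _ (Submodule.subset_span ⟨k, a, ha, n, p, hp, _, rfl⟩)

lemma tensorScale_restrictedChiralImage {w : ℂ} (hw : w ≠ 0) :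
    (restrictedChiralImage S₁ S₂ S₃ w).map (tensorScaleEquiv S₁ S₂ S₃ hw).toLinearMap
      = restrictedChiralImage S₁ S₂ S₃ 1 := by
  refine le_antisymm ?_ fun t ht => ?_
  · have h := tensorScale_restrictedChiralImage_le S₁ S₂ S₃ hw 1
    rw [mul_one] at h
    exact h
  · refine ⟨(tensorScaleEquiv S₁ S₂ S₃ hw).symm t, ?_, LinearEquiv.apply_symm_apply _ t⟩
    -- The reverse inclusion is the same statement for the inverse scaling, from `w⁻¹ * w = 1` back
    -- to `w`.
    have h := tensorScale_restrictedChiralImage_le S₁ S₂ S₃ (inv_ne_zero hw) w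
    rw [inv_mul_cancel₀ hw] at h
    exact h ⟨t, ht, rfl⟩

/-- The isomorphism between `1`-restricted and `w`-restricted conformal blocks. -/
def blocksScale {w : ℂ} (hw : w ≠ 0) :
    RestrictedConformalBlocks S₁ S₂ S₃ 1 ≃ₗ[ℂ] RestrictedConformalBlocks S₁ S₂ S₃ w :=
  (Submodule.Quotient.equiv _ _ (tensorScaleEquiv S₁ S₂ S₃ hw)
    (tensorScale_restrictedChiralImage S₁ S₂ S₃ hw)).dualMap

lemma eval_blocksScale {w : ℂ} (hw : w ≠ 0) (φ : RestrictedConformalBlocks S₁ S₂ S₃ 1) {m d : ℤ}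
    {f : S₃.Contragredient} (hf : f ∈ S₃.dualGr m) (v₁ : S₁.gr 0) {v₂ : M₂} (hv : v₂ ∈ S₂.gr d) :
    (blocksScale S₁ S₂ S₃ hw φ).eval f v₁ v₂ = φ.eval f v₁ v₂ * w ^ (m - d) := by
  change φ (Submodule.Quotient.mk (tensorScale S₁ S₂ S₃ w (f ⊗ₜ (v₁ ⊗ₜ v₂)))) = _
  rw [tensorScale_tmul S₁ S₂ S₃ hw hf v₁ hv, Submodule.Quotient.mk_smul, map_smul, smul_eq_mul,
    mul_comm]
  rfl

end Blocks

/-! ### Recovering vectors from functionals by reflexivity of the graded pieces. -/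

namespace OrdinaryModule

variable {V : Type*} [AddCommGroup V] [Module ℂ V] {A : VertexOperatorAlgebra V}
variable {M : Type*} [AddCommGroup M] [Module ℂ M] (S : OrdinaryModule A M)

/-- The element of `M(m) = M(m)^{**}` given by a functional on the contragredient module. -/
def ofDual (m : ℤ) : Module.Dual ℂ S.Contragredient →ₗ[ℂ] M :=
  haveI := S.finiteDimensional m
  (S.gr m).subtype ∘ₗ (Module.evalEquiv ℂ (S.gr m)).symm.toLinearMap ∘ₗ (S.dualInclusion m).dualMap

lemma ofDual_mem (m : ℤ) (α : Module.Dual ℂ S.Contragredient) : S.ofDual m α ∈ S.gr m :=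
  Subtype.property _

lemma pairing_ofDual (m : ℤ) (α : Module.Dual ℂ S.Contragredient) {i : ℤ} {f : S.Contragredient}
    (hf : f ∈ S.dualGr i) : S.pairing f (S.ofDual m α) = if i = m then α f else 0 := by
  have := S.finiteDimensional m
  split_ifs with h
  · subst h
    have e := Module.apply_evalEquiv_symm_apply ℂ (S.gr i) (S.pairing f ∘ₗ (S.gr i).subtype)
      ((S.dualInclusion i).dualMap α)
    rw [LinearMap.dualMap_apply, S.dualInclusion_restrict hf] at e
    exact e
  · exact hf m (Ne.symm h) _ (S.ofDual_mem m α)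

end OrdinaryModule

/-! ### Functionals versus modes, and the matrix coefficients of the axioms. -/

section Modes

variable {V : Type*} [AddCommGroup V] [Module ℂ V] {A : VertexOperatorAlgebra V}
  {M₁ M₂ M₃ : Type*} [AddCommGroup M₁] [Module ℂ M₁] [AddCommGroup M₂] [Module ℂ M₂]
  [AddCommGroup M₃] [Module ℂ M₃] (S₁ : OrdinaryModule A M₁) (S₂ : OrdinaryModule A M₂)
  (S₃ : OrdinaryModule A M₃)

lemma hom_ext_pairing {g g' : M₂ →ₗ[ℂ] M₃}
    (h : ∀ m, ∀ f ∈ S₃.dualGr m, ∀ d, ∀ v₂ ∈ S₂.gr d,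
      S₃.pairing f (g v₂) = S₃.pairing f (g' v₂)) : g = g' :=
  S₂.hom_ext fun d v₂ hv => sub_eq_zero.mp <| S₃.eq_zero_of_pairing fun m f hf => by
    rw [map_sub, h m f hf d v₂ hv, sub_self]

/-- The functional `F` on `(M³)' ⊗ M¹(0) ⊗ M²` has the matrix coefficients of the modes `Φ`. -/
def HasModes (F : Module.Dual ℂ (S₃.Contragredient ⊗[ℂ] (S₁.gr 0 ⊗[ℂ] M₂)))
    (Φ : S₁.gr 0 →ₗ[ℂ] (ℤ → (M₂ →ₗ[ℂ] M₃))) : Prop :=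
  ∀ (m : ℤ), ∀ f ∈ S₃.dualGr m, ∀ (v₁ : S₁.gr 0) (d : ℤ), ∀ v₂ ∈ S₂.gr d, ∀ n : ℤ,
    S₃.pairing f (Φ v₁ n v₂) = if m = d - n - 1 then F (f ⊗ₜ (v₁ ⊗ₜ v₂)) else 0

variable {S₁ S₂ S₃}

lemma HasModes.modes_unique {F : Module.Dual ℂ (S₃.Contragredient ⊗[ℂ] (S₁.gr 0 ⊗[ℂ] M₂))}
    {Φ Ψ : S₁.gr 0 →ₗ[ℂ] (ℤ → (M₂ →ₗ[ℂ] M₃))} (h : HasModes S₁ S₂ S₃ F Φ)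
    (h' : HasModes S₁ S₂ S₃ F Ψ) : Φ = Ψ :=
  LinearMap.ext fun v₁ => funext fun n => hom_ext_pairing S₂ S₃ fun m f hf d v₂ hv => by
    rw [h m f hf v₁ d v₂ hv, h' m f hf v₁ d v₂ hv]

/-- Each pair of degrees `(m, d)` is seen by exactly one mode, `n = d - m - 1`. -/
lemma HasModes.form_unique {F G : Module.Dual ℂ (S₃.Contragredient ⊗[ℂ] (S₁.gr 0 ⊗[ℂ] M₂))}
    {Φ : S₁.gr 0 →ₗ[ℂ] (ℤ → (M₂ →ₗ[ℂ] M₃))} (h : HasModes S₁ S₂ S₃ F Φ)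
    (h' : HasModes S₁ S₂ S₃ G Φ) : F = G :=
  tensor_hom_ext S₁ S₂ S₃ fun m f hf v₁ d v₂ hv => by
    have e : m = d - (d - m - 1) - 1 := by ring
    have h1 := h m f hf v₁ d v₂ hv (d - m - 1)
    have h2 := h' m f hf v₁ d v₂ hv (d - m - 1)
    rw [if_pos e] at h1 h2
    rw [← h1, ← h2]

lemma HasModes.mem_gr {F : Module.Dual ℂ (S₃.Contragredient ⊗[ℂ] (S₁.gr 0 ⊗[ℂ] M₂))}
    {Φ : S₁.gr 0 →ₗ[ℂ] (ℤ → (M₂ →ₗ[ℂ] M₃))} (h : HasModes S₁ S₂ S₃ F Φ) (v₁ : S₁.gr 0) {d : ℤ}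
    {v₂ : M₂} (hv : v₂ ∈ S₂.gr d) (n : ℤ) : Φ v₁ n v₂ ∈ S₃.gr (d - n - 1) := by
  refine S₃.mem_gr_of_proj fun i hi => (Module.forall_dual_apply_eq_zero_iff ℂ _).mp fun g => ?_
  have e := h i _ (S₃.dualInclusion_mem i g) v₁ d v₂ hv n
  rwa [if_neg hi, S₃.pairing_dualInclusion] at e

/-- For `n ≥ d` the image of `M²(d)` would lie in a negative degree of `M³`. -/
lemma isTruncated_of_mem_gr {Φ : S₁.gr 0 →ₗ[ℂ] (ℤ → (M₂ →ₗ[ℂ] M₃))}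
    (h : ∀ (v₁ : S₁.gr 0) (d : ℤ), ∀ v₂ ∈ S₂.gr d, ∀ n, Φ v₁ n v₂ ∈ S₃.gr (d - n - 1)) :
    IsTruncated Φ := by
  intro v₁ v₂
  refine S₂.homogeneous_induction (P := fun v₂ => ∃ N : ℤ, ∀ n ≥ N, Φ v₁ n v₂ = 0)
    ⟨0, fun _ _ => map_zero _⟩ (fun d v hv => ⟨d, fun n hn => ?_⟩) ?_ v₂
  · have h1 := h v₁ d v hv n
    rwa [S₃.gr_neg _ (by omega), Submodule.mem_bot] at h1
  · rintro x y ⟨N, hN⟩ ⟨N', hN'⟩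
    exact ⟨max N N', fun n hn => by
      rw [map_add, hN n (le_trans (le_max_left _ _) hn), hN' n (le_trans (le_max_right _ _) hn),
        add_zero]⟩

variable (S₁ S₂ S₃)

/-- The functional `v₃' ↦ F (v₃' ⊗ v₁ ⊗ v₂)`, as a bilinear function of `v₁` and `v₂`. -/
def formFlip (F : Module.Dual ℂ (S₃.Contragredient ⊗[ℂ] (S₁.gr 0 ⊗[ℂ] M₂))) :
    S₁.gr 0 →ₗ[ℂ] M₂ →ₗ[ℂ] Module.Dual ℂ S₃.Contragredient :=
  TensorProduct.curry (TensorProduct.curry F).flip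

/-- The `n`-th mode determined by a functional on `(M³)' ⊗ M¹(0) ⊗ M²`. -/
def modeOfForm (F : Module.Dual ℂ (S₃.Contragredient ⊗[ℂ] (S₁.gr 0 ⊗[ℂ] M₂))) (v₁ : S₁.gr 0)
    (n : ℤ) : M₂ →ₗ[ℂ] M₃ :=
  S₂.lift fun d => S₃.ofDual (d - n - 1) ∘ₗ formFlip S₁ S₃ F v₁ ∘ₗ (S₂.gr d).subtype

lemma pairing_modeOfForm (F : Module.Dual ℂ (S₃.Contragredient ⊗[ℂ] (S₁.gr 0 ⊗[ℂ] M₂)))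
    {m : ℤ} {f : S₃.Contragredient} (hf : f ∈ S₃.dualGr m) (v₁ : S₁.gr 0) {d : ℤ} {v₂ : M₂}
    (hv : v₂ ∈ S₂.gr d) (n : ℤ) : S₃.pairing f (modeOfForm S₁ S₂ S₃ F v₁ n v₂)
      = if m = d - n - 1 then F (f ⊗ₜ (v₁ ⊗ₜ v₂)) else 0 := by
  rw [modeOfForm, S₂.lift_of_mem _ hv]
  exact S₃.pairing_ofDual _ _ hf

/-- The modes determined by a functional on `(M³)' ⊗ M¹(0) ⊗ M²`. -/
def modesOfForm : Module.Dual ℂ (S₃.Contragredient ⊗[ℂ] (S₁.gr 0 ⊗[ℂ] M₂)) →ₗ[ℂ]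
    S₁.gr 0 →ₗ[ℂ] (ℤ → (M₂ →ₗ[ℂ] M₃)) :=
  LinearMap.mk₂ ℂ (modeOfForm S₁ S₂ S₃)
    (fun F G v₁ => funext fun n => hom_ext_pairing S₂ S₃ fun m f hf d v₂ hv => by
      rw [Pi.add_apply, LinearMap.add_apply, map_add]
      simp only [pairing_modeOfForm S₁ S₂ S₃ _ hf _ hv]
      split_ifs <;> simp)
    (fun c F v₁ => funext fun n => hom_ext_pairing S₂ S₃ fun m f hf d v₂ hv => by
      rw [Pi.smul_apply, LinearMap.smul_apply, map_smul]
      simp only [pairing_modeOfForm S₁ S₂ S₃ _ hf _ hv]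
      split_ifs <;> simp)
    (fun F v₁ v₁' => funext fun n => hom_ext_pairing S₂ S₃ fun m f hf d v₂ hv => by
      rw [Pi.add_apply, LinearMap.add_apply, map_add]
      simp only [pairing_modeOfForm S₁ S₂ S₃ _ hf _ hv]
      split_ifs <;> simp [TensorProduct.add_tmul, TensorProduct.tmul_add])
    (fun c F v₁ => funext fun n => hom_ext_pairing S₂ S₃ fun m f hf d v₂ hv => by
      rw [Pi.smul_apply, LinearMap.smul_apply, map_smul]
      simp only [pairing_modeOfForm S₁ S₂ S₃ _ hf _ hv]
      split_ifs <;> simp [← TensorProduct.smul_tmul'])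

lemma hasModes_modesOfForm (F : Module.Dual ℂ (S₃.Contragredient ⊗[ℂ] (S₁.gr 0 ⊗[ℂ] M₂))) :
    HasModes S₁ S₂ S₃ F (modesOfForm S₁ S₂ S₃ F) :=
  fun _ _ hf v₁ _ _ hv n => pairing_modeOfForm S₁ S₂ S₃ F hf v₁ hv n

variable {S₁ S₂ S₃}

/-- The matrix coefficients of the restricted Jacobi identity are the relations defining
`1`-restricted conformal blocks. -/
lemma HasModes.pairing_jacobi {F : Module.Dual ℂ (S₃.Contragredient ⊗[ℂ] (S₁.gr 0 ⊗[ℂ] M₂))}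
    {Φ : S₁.gr 0 →ₗ[ℂ] (ℤ → (M₂ →ₗ[ℂ] M₃))} (hF : HasModes S₁ S₂ S₃ F Φ) (hΦ : IsTruncated Φ)
    {k : ℤ} {a : V} (ha : a ∈ A.gr k) (v₁ : S₁.gr 0) (n q : ℤ) {m : ℤ} {f : S₃.Contragredient}
    (hf : f ∈ S₃.dualGr m) {d : ℤ} {v₂ : M₂} (hv : v₂ ∈ S₂.gr d) :
    S₃.pairing f (∑ᶠ j : ℕ, ((-1 : ℂ) ^ j * (Ring.choose (k - 1) j : ℤ)) •
          S₃.Y a (n + (k - 1) - j) (Φ v₁ (q + j) v₂)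
        - ∑ᶠ j : ℕ, ((-1 : ℂ) ^ (k - 1 - j) * (Ring.choose (k - 1) j : ℤ)) •
          Φ v₁ (q + (k - 1) - j) (S₂.Y a (n + j) v₂)
        - Φ (S₁.zeroMode ha v₁) (q + n) v₂)
      = if m = d - (q + n) - 1 then
          -F (restrictedChiralAction S₁ S₂ S₃ 1 ha n le_rfl (f ⊗ₜ (v₁ ⊗ₜ v₂))) else 0 := by
  obtain ⟨N₁, hN₁⟩ := hΦ v₁ v₂
  obtain ⟨N₂, hN₂⟩ := S₂.truncation a v₂
  obtain ⟨N₃, hN₃⟩ := S₃.dualOppositeMode_truncation ha f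
  -- The bound is a maximum so that this sum and the one in `s₃`, which truncate for different
  -- reasons, run over the same range and can be compared termwise.
  have s₁ : ∀ j ≥ max (N₁ - q).toNat (n + (k - 1) - N₃).toNat,
      ((-1 : ℂ) ^ j * (Ring.choose (k - 1) j : ℤ)) •
        S₃.Y a (n + (k - 1) - j) (Φ v₁ (q + j) v₂) = 0 := fun j hj => by
    rw [hN₁ _ (by omega), map_zero, smul_zero]
  have s₂ : ∀ j ≥ (N₂ - n).toNat, ((-1 : ℂ) ^ (k - 1 - j) * (Ring.choose (k - 1) j : ℤ)) •
      Φ v₁ (q + (k - 1) - j) (S₂.Y a (n + j) v₂) = 0 := fun j hj => by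
    rw [hN₂ _ (by omega), map_zero, smul_zero]
  have s₃ : ∀ j ≥ max (N₁ - q).toNat (n + (k - 1) - N₃).toNat,
      ((Ring.choose (k - 1) j : ℤ) * (-1) ^ j : ℂ) •
        S₃.dualOppositeMode ha (n + (k - 1) - j) f = 0 := fun j hj => by
    rw [hN₃ _ (by omega), smul_zero]
  have s₄ : ∀ j ≥ (N₂ - n).toNat, ((Ring.choose (k - 1) j : ℤ) * (-1) ^ (k - 1 - j) : ℂ) •
      S₂.Y a (n + j) v₂ = 0 := fun j hj => by
    rw [hN₂ _ (by omega), smul_zero]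
  rw [restrictedChiralAction_tmul, S₃.rhoInfty_apply, S₂.rhoZero_apply, S₁.rhoWBottom_eq,
    if_pos rfl, one_zpow, one_smul, finsum_eq_sum_range_of_eventually_zero s₁,
    finsum_eq_sum_range_of_eventually_zero s₂, finsum_eq_sum_range_of_eventually_zero s₃,
    finsum_eq_sum_range_of_eventually_zero s₄]
  simp only [map_sub, map_sum, map_smul, map_add, TensorProduct.neg_tmul, TensorProduct.sum_tmul,
    TensorProduct.tmul_sum, ← TensorProduct.smul_tmul', TensorProduct.tmul_smul, map_neg]
  rw [hF m f hf (S₁.zeroMode ha v₁) d v₂ hv]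
  -- The transpose moves the mode of `a` onto `f`. Here and in `t₂` the index `j` drops out of the
  -- degree condition, so a single case distinction serves the whole identity.
  have t₁ : ∀ j : ℕ, S₃.pairing f (S₃.Y a (n + (k - 1) - j) (Φ v₁ (q + j) v₂))
      = if m = d - (q + n) - 1 then
          F (S₃.dualOppositeMode ha (n + (k - 1) - j) f ⊗ₜ (v₁ ⊗ₜ v₂)) else 0 := fun j => by
    rw [← S₃.pairing_dualOppositeMode ha,
      hF _ _ (S₃.dualOppositeMode_mem ha (n + (k - 1) - j) hf) v₁ d v₂ hv]
    exact if_congr (by constructor <;> intro h <;> linarith) rfl rfl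
  have t₂ : ∀ j : ℕ, S₃.pairing f (Φ v₁ (q + (k - 1) - j) (S₂.Y a (n + j) v₂))
      = if m = d - (q + n) - 1 then F (f ⊗ₜ (v₁ ⊗ₜ S₂.Y a (n + j) v₂)) else 0 := fun j => by
    rw [hF m f hf v₁ _ _ (S₂.grading k (n + j) d a ha v₂ hv)]
    exact if_congr (by constructor <;> intro h <;> linarith) rfl rfl
  simp only [t₁, t₂]
  split_ifs with h
  · simp only [smul_eq_mul, mul_comm ((-1 : ℂ) ^ (_ : ℕ)), mul_comm ((-1 : ℂ) ^ (_ : ℤ))]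
    ring
  · simp

/-- The restricted Jacobi identity for the Virasoro element. -/
lemma virasoro_relation_of_jacobi {Φ : S₁.gr 0 →ₗ[ℂ] (ℤ → (M₂ →ₗ[ℂ] M₃))}
    (h : ∀ (k : ℤ) (a : V) (ha : a ∈ A.gr k) (v₁ : S₁.gr 0) (v₂ : M₂) (n q : ℤ),
      ∑ᶠ j : ℕ, ((-1 : ℂ) ^ j * (Ring.choose (k - 1) j : ℤ)) •
          S₃.Y a (n + (k - 1) - j) (Φ v₁ (q + j) v₂)
        - ∑ᶠ j : ℕ, ((-1 : ℂ) ^ (k - 1 - j) * (Ring.choose (k - 1) j : ℤ)) •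
          Φ v₁ (q + (k - 1) - j) (S₂.Y a (n + j) v₂)
        = Φ (S₁.zeroMode ha v₁) (q + n) v₂) (v₁ : S₁.gr 0) (v₂ : M₂) (q : ℤ) :
    (S₃.Y A.omega 1 (Φ v₁ q v₂) - S₃.Y A.omega 0 (Φ v₁ (q + 1) v₂))
      - (Φ v₁ q (S₂.Y A.omega 1 v₂) - Φ v₁ (q + 1) (S₂.Y A.omega 0 v₂)) = S₁.h • Φ v₁ q v₂ := by
  have hc : ∀ j ≥ 2, Ring.choose (2 - 1 : ℤ) j = 0 := fun j hj => by
    rw [show (2 - 1 : ℤ) = ((1 : ℕ) : ℤ) by norm_num, Ring.choose_natCast,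
      Nat.choose_eq_zero_of_lt (by omega)]
    rfl
  -- Weight `2` makes the binomial factor `z - w`, leaving the terms `j = 0, 1`; with `n = 0` these
  -- involve `ω(1) = L(0)` and `ω(0) = L(-1)`.
  have h1 := h 2 A.omega A.omega_mem v₁ v₂ 0 q
  have hz : S₁.zeroMode A.omega_mem v₁ = S₁.h • v₁ := by
    refine Subtype.ext ?_
    have := S₁.L0_eigen 0 v₁ v₁.2
    rw [Int.cast_zero, add_zero] at this
    exact this
  rw [finsum_eq_sum_range_of_eventually_zero (N := 2) fun j hj => by
      rw [hc j hj, Int.cast_zero, mul_zero, zero_smul],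
    finsum_eq_sum_range_of_eventually_zero (N := 2) fun j hj => by
      rw [hc j hj, Int.cast_zero, mul_zero, zero_smul], hz] at h1
  simp only [Finset.sum_range_succ, Finset.sum_range_zero, Ring.choose_zero_right, map_smul,
    Ring.choose_one_right, Pi.smul_apply, LinearMap.smul_apply] at h1
  norm_num at h1
  rw [← h1]
  abel

/-- On `v₂ ∈ M²(d)` the Virasoro relation reads `(L(0) - h₁ - h₂ - d) v₁(n)v₂ = [L(-1), v₁(n+1)]
v₂`. The right side equals `(-n-1-h) v₁(n)v₂` exactly when `v₁(n)v₂` has `L(0)`-eigenvalue `h₃ + d -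
n - 1`. -/
lemma derivative_iff_mem_gr {Φ : S₁.gr 0 →ₗ[ℂ] (ℤ → (M₂ →ₗ[ℂ] M₃))}
    (h : ∀ (k : ℤ) (a : V) (ha : a ∈ A.gr k) (v₁ : S₁.gr 0) (v₂ : M₂) (n q : ℤ),
      ∑ᶠ j : ℕ, ((-1 : ℂ) ^ j * (Ring.choose (k - 1) j : ℤ)) •
          S₃.Y a (n + (k - 1) - j) (Φ v₁ (q + j) v₂)
        - ∑ᶠ j : ℕ, ((-1 : ℂ) ^ (k - 1 - j) * (Ring.choose (k - 1) j : ℤ)) •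
          Φ v₁ (q + (k - 1) - j) (S₂.Y a (n + j) v₂)
        = Φ (S₁.zeroMode ha v₁) (q + n) v₂) :
    (∀ (v₁ : S₁.gr 0) (n : ℤ), S₃.Y A.omega 0 ∘ₗ Φ v₁ n - Φ v₁ n ∘ₗ S₂.Y A.omega 0
        = (-(n : ℂ) - (S₁.h + S₂.h - S₃.h)) • Φ v₁ (n - 1)) ↔
      ∀ (v₁ : S₁.gr 0) (d : ℤ), ∀ v₂ ∈ S₂.gr d, ∀ n, Φ v₁ n v₂ ∈ S₃.gr (d - n - 1) := by
  constructor
  · intro hd v₁ d v₂ hv n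
    refine S₃.mem_gr_of_L0_eigen ?_
    have h1 := virasoro_relation_of_jacobi h v₁ v₂ n
    have h2 := LinearMap.congr_fun (hd v₁ (n + 1)) v₂
    rw [add_sub_cancel_right, LinearMap.sub_apply, LinearMap.comp_apply, LinearMap.comp_apply,
      LinearMap.smul_apply] at h2
    rw [S₂.L0_eigen d v₂ hv, map_smul] at h1
    push_cast at h2 ⊢
    linear_combination (norm := module) h1 + h2
  · intro hd v₁ n
    refine S₂.hom_ext fun d v₂ hv => ?_
    have h1 := virasoro_relation_of_jacobi h v₁ v₂ (n - 1)
    rw [S₂.L0_eigen d v₂ hv, map_smul, S₃.L0_eigen _ _ (hd v₁ d v₂ hv (n - 1)),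
      sub_add_cancel] at h1
    rw [LinearMap.sub_apply, LinearMap.comp_apply, LinearMap.comp_apply, LinearMap.smul_apply]
    push_cast at h1
    linear_combination (norm := module) -h1

end Modes

/-! ### The isomorphism at `w = 1` and the summed series. -/

section Isomorphism

variable {V : Type*} [AddCommGroup V] [Module ℂ V] {A : VertexOperatorAlgebra V}
  {M₁ M₂ M₃ : Type*} [AddCommGroup M₁] [Module ℂ M₁] [AddCommGroup M₂] [Module ℂ M₂]
  [AddCommGroup M₃] [Module ℂ M₃] {S₁ : OrdinaryModule A M₁} {S₂ : OrdinaryModule A M₂}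
  {S₃ : OrdinaryModule A M₃}

lemma finite_support_pairing {Φ : S₁.gr 0 →ₗ[ℂ] (ℤ → (M₂ →ₗ[ℂ] M₃))}
    (h : ∀ (v₁ : S₁.gr 0) (d : ℤ), ∀ v₂ ∈ S₂.gr d, ∀ n, Φ v₁ n v₂ ∈ S₃.gr (d - n - 1))
    (f : S₃.Contragredient) (v₁ : S₁.gr 0) (v₂ : M₂) :
    (Function.support fun n : ℤ => S₃.pairing f (Φ v₁ n v₂)).Finite := by
  refine S₂.homogeneous_induction
    (P := fun v₂ => (Function.support fun n : ℤ => S₃.pairing f (Φ v₁ n v₂)).Finite)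
    (by simp) (fun d v hv => ?_) (fun x y hx hy => ?_) v₂
  · obtain ⟨K, hK⟩ := f.2
    -- Below this interval `v₁(n)v` has degree at least `K`, where `f` vanishes; above it the degree
    -- is negative.
    refine (Set.finite_Icc (d - K - 1) d).subset fun n hn => ?_
    by_contra hc
    refine hn ?_
    have hm := h v₁ d v hv n
    rw [Set.mem_Icc, not_and_or, not_le, not_le] at hc
    rcases hc with hc | hc
    · exact hK _ (by omega) _ hm
    · rw [S₃.gr_neg _ (by omega), Submodule.mem_bot] at hm
      simp only [hm, map_zero]
  · refine (hx.union hy).subset ?_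
    simp only [map_add]
    exact Function.support_add _ _

/-- The functional `v₃' ⊗ v₁ ⊗ v₂ ↦ ∑ₙ ⟨v₃', v₁(n) v₂⟩`. -/
def formOfModes (Φ : S₁.gr 0 →ₗ[ℂ] (ℤ → (M₂ →ₗ[ℂ] M₃)))
    (h : ∀ (v₁ : S₁.gr 0) (d : ℤ), ∀ v₂ ∈ S₂.gr d, ∀ n, Φ v₁ n v₂ ∈ S₃.gr (d - n - 1)) :
    Module.Dual ℂ (S₃.Contragredient ⊗[ℂ] (S₁.gr 0 ⊗[ℂ] M₂)) :=
  TensorProduct.lift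
    { toFun := fun f => TensorProduct.lift <| LinearMap.mk₂ ℂ
        (fun v₁ v₂ => ∑ᶠ n : ℤ, S₃.pairing f (Φ v₁ n v₂))
        (fun v₁ v₁' v₂ => by
          simp only [map_add, Pi.add_apply, LinearMap.add_apply]
          exact finsum_add_distrib (finite_support_pairing h f v₁ v₂)
            (finite_support_pairing h f v₁' v₂))
        (fun c v₁ v₂ => by
          simp only [map_smul, Pi.smul_apply, LinearMap.smul_apply]
          exact (smul_finsum c _).symm)
        (fun v₁ v₂ v₂' => by
          simp only [map_add]
          exact finsum_add_distrib (finite_support_pairing h f v₁ v₂)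
            (finite_support_pairing h f v₁ v₂'))
        (fun c v₁ v₂ => by
          simp only [map_smul]
          exact (smul_finsum c _).symm)
      map_add' := fun f g => TensorProduct.ext' fun v₁ v₂ => by
        simp only [TensorProduct.lift.tmul, LinearMap.mk₂_apply, map_add, LinearMap.add_apply]
        exact finsum_add_distrib (finite_support_pairing h f v₁ v₂)
          (finite_support_pairing h g v₁ v₂)
      map_smul' := fun c f => TensorProduct.ext' fun v₁ v₂ => by
        simp only [TensorProduct.lift.tmul, LinearMap.mk₂_apply, map_smul, LinearMap.smul_apply]
        exact (smul_finsum c _).symm }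

/-- On homogeneous vectors the sum over all modes collapses to the one compatible with the degrees.
-/
lemma hasModes_formOfModes (Φ : S₁.gr 0 →ₗ[ℂ] (ℤ → (M₂ →ₗ[ℂ] M₃)))
    (h : ∀ (v₁ : S₁.gr 0) (d : ℤ), ∀ v₂ ∈ S₂.gr d, ∀ n, Φ v₁ n v₂ ∈ S₃.gr (d - n - 1)) :
    HasModes S₁ S₂ S₃ (formOfModes Φ h) Φ := by
  intro m f hf v₁ d v₂ hv n
  have hz : ∀ i : ℤ, m ≠ d - i - 1 → S₃.pairing f (Φ v₁ i v₂) = 0 := fun i hi =>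
    hf _ hi.symm _ (h v₁ d v₂ hv i)
  split_ifs with hm
  · change _ = ∑ᶠ i : ℤ, S₃.pairing f (Φ v₁ i v₂)
    rw [finsum_eq_single _ n fun i hi => hz i (by omega)]
  · exact hz n hm

/-- The modes of a functional vanishing on the image of the `1`-restricted chiral Lie algebra form
a generalized intertwining operator. -/
lemma HasModes.mem_generalizedIntertwiningOperators
    {F : Module.Dual ℂ (S₃.Contragredient ⊗[ℂ] (S₁.gr 0 ⊗[ℂ] M₂))}
    {Φ : S₁.gr 0 →ₗ[ℂ] (ℤ → (M₂ →ₗ[ℂ] M₃))} (h : HasModes S₁ S₂ S₃ F Φ)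
    (hF : restrictedChiralImage S₁ S₂ S₃ 1 ≤ LinearMap.ker F) :
    Φ ∈ GeneralizedIntertwiningOperators S₁ S₂ S₃ := by
  have hgr : ∀ (v₁ : S₁.gr 0) (d : ℤ), ∀ v₂ ∈ S₂.gr d, ∀ n, Φ v₁ n v₂ ∈ S₃.gr (d - n - 1) :=
    fun v₁ d v₂ hv n => h.mem_gr v₁ hv n
  have ht := isTruncated_of_mem_gr hgr
  have hJ : ∀ (k : ℤ) (a : V) (ha : a ∈ A.gr k) (v₁ : S₁.gr 0) (v₂ : M₂) (n q : ℤ),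
      ∑ᶠ j : ℕ, ((-1 : ℂ) ^ j * (Ring.choose (k - 1) j : ℤ)) •
          S₃.Y a (n + (k - 1) - j) (Φ v₁ (q + j) v₂)
        - ∑ᶠ j : ℕ, ((-1 : ℂ) ^ (k - 1 - j) * (Ring.choose (k - 1) j : ℤ)) •
          Φ v₁ (q + (k - 1) - j) (S₂.Y a (n + j) v₂)
        = Φ (S₁.zeroMode ha v₁) (q + n) v₂ := by
    intro k a ha v₁ v₂ n q
    have fin₁ : ∀ v₂, (Function.support fun j : ℕ => ((-1 : ℂ) ^ j * (Ring.choose (k - 1) j : ℤ)) •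
        S₃.Y a (n + (k - 1) - j) (Φ v₁ (q + j) v₂)).Finite := fun v₂ => by
      obtain ⟨N, hN⟩ := ht v₁ v₂
      refine finite_support_of_eventually_zero _ (N - q).toNat fun j hj => ?_
      rw [hN _ (by omega), map_zero, smul_zero]
    have fin₂ : ∀ v₂, (Function.support fun j : ℕ =>
        ((-1 : ℂ) ^ (k - 1 - j) * (Ring.choose (k - 1) j : ℤ)) •
          Φ v₁ (q + (k - 1) - j) (S₂.Y a (n + j) v₂)).Finite := fun v₂ => by
      obtain ⟨N, hN⟩ := S₂.truncation a v₂
      refine finite_support_of_eventually_zero _ (N - n).toNat fun j hj => ?_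
      rw [hN _ (by omega), map_zero, smul_zero]
    refine S₂.homogeneous_induction (P := fun v₂ =>
      ∑ᶠ j : ℕ, ((-1 : ℂ) ^ j * (Ring.choose (k - 1) j : ℤ)) •
          S₃.Y a (n + (k - 1) - j) (Φ v₁ (q + j) v₂)
        - ∑ᶠ j : ℕ, ((-1 : ℂ) ^ (k - 1 - j) * (Ring.choose (k - 1) j : ℤ)) •
          Φ v₁ (q + (k - 1) - j) (S₂.Y a (n + j) v₂)
        = Φ (S₁.zeroMode ha v₁) (q + n) v₂) (by simp) (fun d v hv => ?_) (fun x y hx hy => ?_) v₂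
    · rw [← sub_eq_zero]
      -- Tested on homogeneous functionals, the identity is a block relation in the matching degree
      -- and trivial in the others.
      refine S₃.eq_zero_of_pairing fun m f hf => ?_
      rw [h.pairing_jacobi ht ha v₁ n q hf hv]
      split_ifs
      · rw [neg_eq_zero]
        exact hF (Submodule.subset_span ⟨k, a, ha, n, k - 1, le_rfl, _, rfl⟩)
      · rfl
    · simp only [map_add, smul_add]
      rw [finsum_add_distrib (fin₁ x) (fin₁ y), finsum_add_distrib (fin₂ x) (fin₂ y), ← hx, ← hy]
      abel
  exact ⟨ht, (derivative_iff_mem_gr hJ).mpr hgr, hJ⟩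

lemma mem_gr_of_mem_generalizedIntertwiningOperators
    {Φ : S₁.gr 0 →ₗ[ℂ] (ℤ → (M₂ →ₗ[ℂ] M₃))}
    (h : Φ ∈ GeneralizedIntertwiningOperators S₁ S₂ S₃) (v₁ : S₁.gr 0) (d : ℤ) (v₂ : M₂)
    (hv : v₂ ∈ S₂.gr d) (n : ℤ) : Φ v₁ n v₂ ∈ S₃.gr (d - n - 1) :=
  (derivative_iff_mem_gr h.2.2).mp h.2.1 v₁ d v₂ hv n

/-- A functional whose modes form a generalized intertwining operator vanishes on the image of the
`1`-restricted chiral Lie algebra. -/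
lemma HasModes.restrictedChiralImage_le_ker
    {F : Module.Dual ℂ (S₃.Contragredient ⊗[ℂ] (S₁.gr 0 ⊗[ℂ] M₂))}
    {Φ : S₁.gr 0 →ₗ[ℂ] (ℤ → (M₂ →ₗ[ℂ] M₃))} (h : HasModes S₁ S₂ S₃ F Φ)
    (hΦ : Φ ∈ GeneralizedIntertwiningOperators S₁ S₂ S₃) :
    restrictedChiralImage S₁ S₂ S₃ 1 ≤ LinearMap.ker F := by
  refine vanishes_on_restrictedChiralImage S₁ S₂ S₃ one_ne_zero fun k a ha n m f hf v₁ d v₂ hv => ?_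
  -- This `q` is the one solving `m = d - (q + n) - 1`, so the coefficient is the block relation and
  -- not zero for degree reasons.
  have e := h.pairing_jacobi hΦ.1 ha v₁ n (d - m - n - 1) hf hv
  rw [if_pos (by ring), hΦ.2.2 k a ha v₁ v₂ n (d - m - n - 1), sub_self, map_zero] at e
  exact neg_eq_zero.mp e.symm

variable (S₁ S₂ S₃)

/-- The functional on `(M³)' ⊗ M¹(0) ⊗ M²` underlying a restricted conformal block. -/
def blockForm (w : ℂ) : RestrictedConformalBlocks S₁ S₂ S₃ w →ₗ[ℂ]
    Module.Dual ℂ (S₃.Contragredient ⊗[ℂ] (S₁.gr 0 ⊗[ℂ] M₂)) :=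
  (restrictedChiralImage S₁ S₂ S₃ w).mkQ.dualMap

lemma blockForm_tmul {w : ℂ} (φ : RestrictedConformalBlocks S₁ S₂ S₃ w) (f : S₃.Contragredient)
    (v₁ : S₁.gr 0) (v₂ : M₂) : blockForm S₁ S₂ S₃ w φ (f ⊗ₜ (v₁ ⊗ₜ v₂)) = φ.eval f v₁ v₂ := rfl

lemma restrictedChiralImage_le_ker_blockForm {w : ℂ} (φ : RestrictedConformalBlocks S₁ S₂ S₃ w) :
    restrictedChiralImage S₁ S₂ S₃ w ≤ LinearMap.ker (blockForm S₁ S₂ S₃ w φ) := fun x hx => by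
  change φ (Submodule.Quotient.mk x) = 0
  rw [(Submodule.Quotient.mk_eq_zero _).mpr hx, map_zero]

/-- The generalized intertwining operator of a `1`-restricted conformal block. -/
def blockIntertwiner : RestrictedConformalBlocks S₁ S₂ S₃ 1 →ₗ[ℂ]
    GeneralizedIntertwiningOperators S₁ S₂ S₃ :=
  LinearMap.codRestrict _ (modesOfForm S₁ S₂ S₃ ∘ₗ blockForm S₁ S₂ S₃ 1) fun φ =>
    (hasModes_modesOfForm S₁ S₂ S₃ _).mem_generalizedIntertwiningOperators
      (restrictedChiralImage_le_ker_blockForm S₁ S₂ S₃ φ)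

lemma hasModes_blockIntertwiner (φ : RestrictedConformalBlocks S₁ S₂ S₃ 1) :
    HasModes S₁ S₂ S₃ (blockForm S₁ S₂ S₃ 1 φ) (blockIntertwiner S₁ S₂ S₃ φ).1 :=
  hasModes_modesOfForm S₁ S₂ S₃ _

/-- Injective because the modes determine the functional; surjective because the sum of all matrix
coefficients descends to the quotient. -/
lemma blockIntertwiner_bijective : Function.Bijective (blockIntertwiner S₁ S₂ S₃) := by
  constructor
  · intro φ ψ h
    have h1 := hasModes_blockIntertwiner S₁ S₂ S₃ φ
    rw [h] at h1
    have h2 := h1.form_unique (hasModes_blockIntertwiner S₁ S₂ S₃ ψ)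
    refine LinearMap.ext fun x => ?_
    obtain ⟨t, rfl⟩ := Submodule.Quotient.mk_surjective _ x
    exact LinearMap.congr_fun h2 t
  · rintro ⟨Φ, hΦ⟩
    have h := hasModes_formOfModes Φ (mem_gr_of_mem_generalizedIntertwiningOperators hΦ)
    exact ⟨Submodule.liftQ _ _ (h.restrictedChiralImage_le_ker hΦ),
      Subtype.ext (HasModes.modes_unique (hasModes_blockIntertwiner S₁ S₂ S₃ _) h)⟩

/-- The isomorphism between `1`-restricted conformal blocks and generalized intertwining
operators. -/
def blockIntertwinerEquiv : RestrictedConformalBlocks S₁ S₂ S₃ 1 ≃ₗ[ℂ]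
    GeneralizedIntertwiningOperators S₁ S₂ S₃ :=
  LinearEquiv.ofBijective (blockIntertwiner S₁ S₂ S₃) (blockIntertwiner_bijective S₁ S₂ S₃)

/-- By linearity in `f` and `v₂` it suffices to take degrees `m` and `d`. Only `n = d - m - 1` then
contributes, and its exponent `-n-1-h` is `(m-d) - h`, whose integer part is the scaling factor of
the block. -/
lemma sum_blockIntertwiner {w : ℂ} (hw : w ≠ 0) (h : ℂ)
    (φ : RestrictedConformalBlocks S₁ S₂ S₃ 1) (f : S₃.Contragredient) (v₁ : S₁.gr 0) (v₂ : M₂) :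
    ∑ᶠ n : ℤ, S₃.pairing f ((blockIntertwiner S₁ S₂ S₃ φ).1 v₁ n v₂) * w ^ (-(n : ℂ) - 1 - h)
      = (blocksScale S₁ S₂ S₃ hw φ).eval f v₁ v₂ * w ^ (-h) := by
  set Φ := (blockIntertwiner S₁ S₂ S₃ φ).1 with hΦ
  have hgr := mem_gr_of_mem_generalizedIntertwiningOperators (blockIntertwiner S₁ S₂ S₃ φ).2
  have fin : ∀ f v₂, (Function.support fun n : ℤ =>
      S₃.pairing f (Φ v₁ n v₂) * w ^ (-(n : ℂ) - 1 - h)).Finite := fun f v₂ =>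
    (finite_support_pairing hgr f v₁ v₂).subset (Function.support_mul_subset_left _ _)
  simp only [← blockForm_tmul]
  set F := blockForm S₁ S₂ S₃ w (blocksScale S₁ S₂ S₃ hw φ) with hF
  refine S₃.dual_homogeneous_induction (P := fun f =>
    ∑ᶠ n : ℤ, S₃.pairing f (Φ v₁ n v₂) * w ^ (-(n : ℂ) - 1 - h)
      = F (f ⊗ₜ (v₁ ⊗ₜ v₂)) * w ^ (-h)) (by simp) (fun m f hf => ?_) (fun f g h₁ h₂ => ?_) f
  · refine S₂.homogeneous_induction (P := fun v₂ =>
      ∑ᶠ n : ℤ, S₃.pairing f (Φ v₁ n v₂) * w ^ (-(n : ℂ) - 1 - h)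
        = F (f ⊗ₜ (v₁ ⊗ₜ v₂)) * w ^ (-h)) (by simp) (fun d v hv => ?_) (fun x y h₁ h₂ => ?_) v₂
    · have hm := hasModes_blockIntertwiner S₁ S₂ S₃ φ m f hf v₁ d v hv
      rw [finsum_eq_single _ (d - m - 1) fun n hn => by
        rw [hm n, if_neg (by omega), zero_mul], hm, if_pos (by ring), hF, blockForm_tmul,
        blockForm_tmul, eval_blocksScale S₁ S₂ S₃ hw φ hf v₁ hv, mul_assoc,
        ← Complex.cpow_intCast, ← Complex.cpow_add _ _ hw]
      congr 2
      push_cast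
      ring
    · simp only [map_add, TensorProduct.tmul_add, add_mul]
      rw [finsum_add_distrib (fin f x) (fin f y), h₁, h₂]
  · simp only [map_add, LinearMap.add_apply, TensorProduct.add_tmul, add_mul]
    rw [finsum_add_distrib (fin f v₂) (fin g v₂), h₁, h₂]

end Isomorphism

end

theorem mainTheorem11 {V : Type*} [AddCommGroup V] [Module ℂ V] {A : VertexOperatorAlgebra V}
    {M₁ M₂ M₃ : Type*} [AddCommGroup M₁] [Module ℂ M₁] [AddCommGroup M₂] [Module ℂ M₂]
    [AddCommGroup M₃] [Module ℂ M₃] (S₁ : OrdinaryModule A M₁) (S₂ : OrdinaryModule A M₂)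
    (S₃ : OrdinaryModule A M₃) (w : ℂ) (hw : w ≠ 0) :
    ∃ (σ : RestrictedConformalBlocks S₁ S₂ S₃ 1 ≃ₗ[ℂ] RestrictedConformalBlocks S₁ S₂ S₃ w)
      (e : RestrictedConformalBlocks S₁ S₂ S₃ w ≃ₗ[ℂ] GeneralizedIntertwiningOperators S₁ S₂ S₃),
      (∀ (φ₁ : RestrictedConformalBlocks S₁ S₂ S₃ 1) (m d : ℤ) (f : S₃.Contragredient) (v₁ : S₁.gr 0)
        (v₂ : M₂), f ∈ S₃.dualGr m → v₂ ∈ S₂.gr d →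
        (RestrictedConformalBlocks.eval (σ φ₁) f v₁ v₂
          = RestrictedConformalBlocks.eval φ₁ f v₁ v₂ * w ^ (m - d)) ∧
        (∀ n : ℤ, S₃.pairing f ((e (σ φ₁)).1 v₁ n v₂)
          = if m = d - n - 1 then RestrictedConformalBlocks.eval φ₁ f v₁ v₂ else 0)) ∧
      (∀ (φ : RestrictedConformalBlocks S₁ S₂ S₃ w) (f : S₃.Contragredient) (v₁ : S₁.gr 0) (v₂ : M₂),
        (Function.support fun n : ℤ => S₃.pairing f ((e φ).1 v₁ n v₂)).Finite ∧
        ∑ᶠ n : ℤ, S₃.pairing f ((e φ).1 v₁ n v₂) * w ^ (-(n : ℂ) - 1 - (S₁.h + S₂.h - S₃.h))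
          = RestrictedConformalBlocks.eval φ f v₁ v₂ * w ^ (-(S₁.h + S₂.h - S₃.h))) := by
  refine ⟨blocksScale S₁ S₂ S₃ hw,
    -- The second isomorphism is the one at `1` after undoing the rescaling.
    (blocksScale S₁ S₂ S₃ hw).symm.trans (blockIntertwinerEquiv S₁ S₂ S₃),
    fun φ₁ m d f v₁ v₂ hf hv => ⟨eval_blocksScale S₁ S₂ S₃ hw φ₁ hf v₁ hv, fun n => ?_⟩,
    fun φ f v₁ v₂ => ?_⟩
  · rw [LinearEquiv.trans_apply, LinearEquiv.symm_apply_apply]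
    exact hasModes_blockIntertwiner S₁ S₂ S₃ φ₁ m f hf v₁ d v₂ hv n
  · obtain ⟨φ₁, rfl⟩ := (blocksScale S₁ S₂ S₃ hw).surjective φ
    rw [LinearEquiv.trans_apply, LinearEquiv.symm_apply_apply]
    exact ⟨finite_support_pairing (mem_gr_of_mem_generalizedIntertwiningOperators
      (blockIntertwiner S₁ S₂ S₃ φ₁).2) f v₁ v₂, sum_blockIntertwiner S₁ S₂ S₃ hw _ φ₁ f v₁ v₂⟩
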